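/- For an integer polynomial $p$ let $H(p)$ be its height (the maximum of the absolute values of its coefficients) and $D(p)$ its discriminant, so that $D(p)=b^2-4ac$ for $p(x)=ax^2+bx+c$. For real $Q>1$ and $D\ge 1$ let $N(Q,D)$ be the number of polynomials $p\in\mathbb{Z}[x]$ with $\deg p=2$, $H(p)\le Q$ and $|D(p)|\le D$. For $0<v<\tfrac34$ let \[ \mathcal{P}_2(Q,v)=\{p\in\mathbb{Z}[x] : \deg p=2,\ H(p)\le Q,\ |D(p)|\le \gamma_2\, Q^{2-2v}\},\qquad \gamma_2=\sup_{p\in\mathbb{Z}[x],\ \deg p=2}\frac{|D(p)|}{H(p)^{2}}=5 . \] Then the following hold. (1) For all real $Q>1$ and $D$ with $1\le D\le Q^2/2$, \[ N(Q,D)=\kappa QD+O\bigl(D^{3/2}\ln Q+(Q\ln Q)^{3/2}\bigr),\qquad \kappa=4(\ln 2+1), \] where the implied constant is absolute. (2) For every fixed $v$ with $0<v<\tfrac34$ there are constants $c_1,c_2>0$, depending only on $v$, such that for all real $Q>1$ \[ c_1Q^{3-2v}\le \#\mathcal{P}_2(Q,v)\le c_2Q^{3-2v}. \] -/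

import Mathlib

open Polynomial

/-- The height of an integer polynomial: the largest absolute value of its coefficients. -/
def polyHeight (p : ℤ[X]) : ℕ :=
  p.support.sup fun i => (p.coeff i).natAbs

/-- The integer polynomials of degree `n` and height at most `Q`. -/
def polysOfHeightLE (n : ℕ) (Q : ℝ) : Set ℤ[X] :=
  {p | p.degree = n ∧ (polyHeight p : ℝ) ≤ Q}

/-- `γ_n`, the supremum of `|D(p)| / H(p) ^ (2n - 2)` over the integer polynomials `p` of
degree `n`. -/
noncomputable def discrGamma (n : ℕ) : ℝ :=
  sSup {t : ℝ | ∃ p : ℤ[X], p.degree = n ∧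
    t = |(p.discr : ℝ)| / (polyHeight p : ℝ) ^ (2 * n - 2)}

/-- `P_n(Q, v)`: the integer polynomials of degree `n` and height at most `Q` whose discriminant
is at most `γ_n Q ^ (2n - 2 - 2v)` in absolute value. -/
def polysOfSmallDiscr (n : ℕ) (Q v : ℝ) : Set ℤ[X] :=
  {p | p ∈ polysOfHeightLE n Q ∧
    |(p.discr : ℝ)| ≤ discrGamma n * Q ^ (2 * (n : ℝ) - 2 - 2 * v)}

/-- `N(Q, D)`: the number of integer polynomials of degree `2` and height at most `Q` whose
discriminant is at most `D` in absolute value. -/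
noncomputable def quadCount (Q D : ℝ) : ℕ :=
  {p : ℤ[X] | p ∈ polysOfHeightLE 2 Q ∧ |(p.discr : ℝ)| ≤ D}.ncard

/-!
Write `p = a x² + b x + c` with `a > 0`. For given `a` and `b`, the map `c ↦ b² - 4ac` identifies
the admissible `c` with the integers `d ≡ b² (mod 4a)`, `|d| ≤ D`, such that `|b² - d| ≤ 4aQ`. The
last condition amounts to `b² ≤ 4aQ` except for the few `b` with `|b² - 4aQ| ≤ D`, which cause the
error `D^(3/2) log Q`.

There remain the pairs `(b, d)` in a box with `b² ≡ d (mod 4a)`. When the congruence is detected by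
the additive characters of `ℤ/4aℤ`, the trivial character gives the expected number of pairs, and
the others give incomplete quadratic Gauss sums, which Weyl differencing bounds. The loss
`gcd(2j, 4a)` in that bound is harmless on average over `a`, and the error is `(Q log Q)^(3/2)`.

The main term `D ∑ min(Q/a, 2√(Q/a))` over `a ≤ Q` approximates `QD ∫₀¹ min(1/t, 2/√t) dt`, which
equals `2(log 2 + 1)QD`; the negative `a` contribute as much.
-/

section ExponentialSums

open Finset ZMod

theorem norm_geom_sum_le {𝕜 : Type*} [NormedField 𝕜] {z : 𝕜} (hz : ‖z‖ = 1) (hz₁ : z ≠ 1) (n : ℕ) :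
    ‖∑ i ∈ range n, z ^ i‖ ≤ 2 / ‖z - 1‖ := by
  rw [geom_sum_eq hz₁, norm_div]
  gcongr
  calc ‖z ^ n - 1‖ ≤ ‖z ^ n‖ + ‖(1 : 𝕜)‖ := norm_sub_le _ _
    _ = 2 := by rw [norm_pow, hz, one_pow, norm_one]; norm_num

theorem norm_sq_sum_le_sum_norm_sum_mul_conj {G 𝕜 : Type*} [AddGroup G] [DecidableEq G] [RCLike 𝕜]
    (f : G → 𝕜) {I K : Finset G} (hK : ∀ b ∈ I, ∀ b' ∈ I, b' - b ∈ K) :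
    ‖∑ b ∈ I, f b‖ ^ 2 ≤ ∑ k ∈ K, ‖∑ b ∈ I with k + b ∈ I, f (k + b) * starRingEnd 𝕜 (f b)‖ := by
  have expand : (∑ b ∈ I, f b) * starRingEnd 𝕜 (∑ b ∈ I, f b) =
      ∑ k ∈ K, ∑ b ∈ I with k + b ∈ I, f (k + b) * starRingEnd 𝕜 (f b) := by
    simp only [sum_filter]
    rw [map_sum, sum_mul_sum, sum_comm, sum_comm (s := K)]
    refine sum_congr rfl fun b hb => ?_
    rw [← sum_filter]
    refine sum_nbij' (· - b) (· + b) (fun b' hb' => ?_) (fun k hk => (mem_filter.mp hk).2)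
      (fun b' _ => sub_add_cancel b' b) (fun k _ => add_sub_cancel_right k b) (fun b' _ => ?_)
    · simpa [hb'] using hK b hb b' hb'
    · rw [sub_add_cancel]
  calc ‖∑ b ∈ I, f b‖ ^ 2 = ‖(∑ b ∈ I, f b) * starRingEnd 𝕜 (∑ b ∈ I, f b)‖ := by
        rw [norm_mul, RCLike.norm_conj, sq]
    _ ≤ _ := expand ▸ norm_sum_le _ _

variable {q : ℕ}

/-- The bound for a sum of at most `N` consecutive powers of the additive character of `ZMod q`
attached to the residue `r`. -/
noncomputable def geomBound (q N : ℕ) (r : ZMod q) : ℝ :=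
  if r = 0 then N else q / (2 * r.valMinAbs.natAbs)

theorem geomBound_nonneg (N : ℕ) (r : ZMod q) : 0 ≤ geomBound q N r := by
  unfold geomBound
  split_ifs <;> positivity

theorem natAbs_valMinAbs_pos {r : ZMod q} (hr : r ≠ 0) : 0 < r.valMinAbs.natAbs :=
  Int.natAbs_pos.mpr ((valMinAbs_eq_zero r).not.mpr hr)

variable [NeZero q]

theorem four_mul_natAbs_valMinAbs_div_le_norm (r : ZMod q) :
    4 * r.valMinAbs.natAbs / q ≤ ‖stdAddChar r - 1‖ := by
  have hq : (0 : ℝ) < q := by exact_mod_cast NeZero.pos q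
  have hr : ((r.valMinAbs.natAbs : ℝ)) / q ≤ 1 / 2 := by
    rw [div_le_div_iff₀ hq two_pos, one_mul]
    exact_mod_cast (Nat.le_div_iff_mul_le two_pos).mp (natAbs_valMinAbs_le r)
  have angle : |2 * Real.pi * r.valMinAbs / q / 2| = Real.pi * (r.valMinAbs.natAbs / q) := by
    rw [Nat.cast_natAbs, Int.cast_abs, abs_div, abs_div, abs_mul, abs_of_pos Real.two_pi_pos,
      Nat.abs_cast, Nat.abs_ofNat]
    ring
  have exp : stdAddChar r = Complex.exp (Complex.I * ↑(2 * Real.pi * r.valMinAbs / q)) := by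
    conv_lhs => rw [← coe_valMinAbs r, stdAddChar_coe]
    push_cast
    ring_nf
  have jordan := Real.mul_abs_le_abs_sin (x := 2 * Real.pi * r.valMinAbs / q / 2) (by
    rw [angle]; nlinarith [Real.pi_pos])
  rw [exp, Complex.norm_exp_I_mul_ofReal_sub_one, norm_mul, Real.norm_ofNat, Real.norm_eq_abs]
  calc (4 * r.valMinAbs.natAbs / q : ℝ)
      = 2 * (2 / Real.pi * (Real.pi * (r.valMinAbs.natAbs / q))) := by field_simp; ring
    _ ≤ _ := by rw [← angle]; gcongr

theorem norm_sum_Ico_stdAddChar_mul_le (r : ZMod q) {x y : ℤ} {N : ℕ} (hxy : y ≤ x + N) :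
    ‖∑ b ∈ Ico x y, stdAddChar (r * b : ZMod q)‖ ≤ geomBound q N r := by
  have geom : ∑ b ∈ Ico x y, stdAddChar (r * b : ZMod q) =
      stdAddChar (r * x : ZMod q) * ∑ i ∈ range (y - x).toNat, stdAddChar r ^ i := by
    rw [Int.Ico_eq_finset_map, sum_map, mul_sum]
    refine sum_congr rfl fun i _ => ?_
    rw [← AddChar.map_nsmul_eq_pow, ← AddChar.map_add_eq_mul]
    congr 1
    simp [mul_add, mul_comm]
  rw [geom, norm_mul, AddChar.norm_apply, one_mul, geomBound]
  split_ifs with hr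
  · have : (y - x).toNat ≤ N := by lia
    simpa [hr] using this
  · have hpos : (0 : ℝ) < r.valMinAbs.natAbs := by exact_mod_cast natAbs_valMinAbs_pos hr
    have hq : (0 : ℝ) < q := by exact_mod_cast NeZero.pos q
    have chord := four_mul_natAbs_valMinAbs_div_le_norm r
    have hne : stdAddChar r ≠ 1 := fun h => by
      rw [h, sub_self, norm_zero] at chord
      exact absurd chord (not_le.mpr (by positivity))
    calc _ ≤ 2 / ‖stdAddChar r - 1‖ := norm_geom_sum_le (AddChar.norm_apply _ _) hne _
      _ ≤ 2 / (4 * r.valMinAbs.natAbs / q) := by gcongr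
      _ = q / (2 * r.valMinAbs.natAbs) := by field_simp; norm_num

theorem norm_sq_sum_Ico_stdAddChar_mul_sq_le (h : ZMod q) (x : ℤ) (N : ℕ) :
    ‖∑ b ∈ Ico x (x + N), stdAddChar (h * b ^ 2 : ZMod q)‖ ^ 2 ≤
      ∑ k ∈ Ico (-N : ℤ) N, geomBound q N (2 * h * k) := by
  refine (norm_sq_sum_le_sum_norm_sum_mul_conj (fun b : ℤ => stdAddChar (h * b ^ 2 : ZMod q))
    (K := Ico (-N : ℤ) N) fun b hb b' hb' => ?_).trans (sum_le_sum fun k _ => ?_)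
  · simp only [mem_Ico] at *
    lia
  have differenced : ∀ b : ℤ, stdAddChar (h * (k + b : ℤ) ^ 2 : ZMod q) *
      starRingEnd ℂ (stdAddChar (h * b ^ 2 : ZMod q)) =
        stdAddChar (h * k ^ 2 : ZMod q) * stdAddChar (2 * h * k * b : ZMod q) := fun b => by
    rw [← AddChar.map_neg_eq_conj, ← AddChar.map_add_eq_mul, ← AddChar.map_add_eq_mul]
    congr 1
    push_cast
    ring
  have interval : ({b ∈ Ico x (x + N) | k + b ∈ Ico x (x + N)} : Finset ℤ) =
      Ico (max x (x - k)) (min (x + N) (x + N - k)) := by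
    ext b
    simp only [mem_filter, mem_Ico]
    lia
  rw [sum_congr rfl fun b _ => differenced b, ← mul_sum, norm_mul, AddChar.norm_apply, one_mul,
    interval]
  exact norm_sum_Ico_stdAddChar_mul_le _ (by lia)

end ExponentialSums

section Residues

open Finset ZMod

theorem sum_Icc_one_filter_dvd {M : Type*} [AddCommMonoid M] (f : ℕ → M) {d : ℕ} (hd : 0 < d)
    (n : ℕ) : ∑ j ∈ Icc 1 n with d ∣ j, f j = ∑ i ∈ Icc 1 (n / d), f (d * i) := by
  symm
  refine sum_nbij (d * ·) (fun i hi => ?_)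
    (fun i _ j _ hij => Nat.eq_of_mul_eq_mul_left hd hij) (fun j hj => ?_) fun _ _ => rfl
  · simp only [mem_filter, mem_Icc] at hi ⊢
    exact ⟨⟨Nat.mul_pos hd hi.1,
      mul_comm i d ▸ (Nat.le_div_iff_mul_le hd).mp hi.2⟩, dvd_mul_right d i⟩
  · simp only [coe_filter, mem_Icc, Set.mem_ofPred_eq] at hj
    obtain ⟨⟨hpos, hle⟩, i, rfl⟩ := hj
    refine ⟨i, ?_, rfl⟩
    exact mem_coe.mpr (mem_Icc.mpr ⟨Nat.pos_of_mul_pos_left hpos,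
      (Nat.le_div_iff_mul_le hd).mpr (mul_comm d i ▸ hle)⟩)

theorem sum_Icc_one_inv_le (n : ℕ) : ∑ j ∈ Icc 1 n, (j : ℝ)⁻¹ ≤ 1 + Real.log n := by
  simpa [harmonic_eq_sum_Icc] using harmonic_le_one_add_log n

theorem sum_Icc_one_filter_dvd_inv_le {d : ℕ} (hd : 0 < d) (n : ℕ) :
    ∑ j ∈ Icc 1 n with d ∣ j, (j : ℝ)⁻¹ ≤ (1 + Real.log n) / d := by
  rw [sum_Icc_one_filter_dvd _ hd]
  calc ∑ i ∈ Icc 1 (n / d), ((d * i : ℕ) : ℝ)⁻¹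
      = (∑ i ∈ Icc 1 (n / d), (i : ℝ)⁻¹) / d := by
        simp only [Nat.cast_mul, mul_inv_rev, sum_mul, div_eq_mul_inv]
    _ ≤ (∑ i ∈ Icc 1 n, (i : ℝ)⁻¹) / d := by
        gcongr
        exact Nat.div_le_self n d
    _ ≤ _ := by
        gcongr
        exact sum_Icc_one_inv_le n

variable {q : ℕ}

theorem gcd_dvd_natAbs_valMinAbs_intCast_mul (τ : ℤ) (k : ZMod q) :
    τ.gcd q ∣ (τ * k : ZMod q).valMinAbs.natAbs := by
  rw [← Int.natCast_dvd]
  have cast_eq : ((τ * k : ZMod q).valMinAbs : ZMod q) = ((τ * k.valMinAbs : ℤ) : ZMod q) := by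
    simp
  rw [intCast_eq_intCast_iff_dvd_sub] at cast_eq
  exact (Int.dvd_iff_dvd_of_dvd_sub ((Int.gcd_dvd_right τ q).trans cast_eq)).mp
    ((Int.gcd_dvd_left τ q).mul_right _)

variable [NeZero q]

theorem card_filter_natAbs_valMinAbs_eq_le (j : ℕ) :
    #{r : ZMod q | r.valMinAbs.natAbs = j} ≤ 2 := by
  refine (card_le_card (t := {(j : ZMod q), -(j : ZMod q)}) fun r hr => ?_).trans card_le_two
  have hr : r.valMinAbs.natAbs = j := (mem_filter.mp hr).2
  rw [mem_insert, mem_singleton, ← coe_valMinAbs r, ← hr]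
  rcases Int.natAbs_eq r.valMinAbs with h | h
  · left
    conv_lhs => rw [h]
    simp
  · right
    conv_lhs => rw [h]
    simp

theorem sum_ne_zero_natAbs_valMinAbs_le {F : ℕ → ℝ} (hF : ∀ j, 0 ≤ F j) :
    ∑ r : ZMod q with r ≠ 0, F r.valMinAbs.natAbs ≤ 2 * ∑ j ∈ Icc 1 (q / 2), F j := by
  have maps : ∀ r ∈ ({r | r ≠ 0} : Finset (ZMod q)), r.valMinAbs.natAbs ∈ Icc 1 (q / 2) :=
    fun r hr => mem_Icc.mpr
      ⟨natAbs_valMinAbs_pos (mem_filter.mp hr).2, natAbs_valMinAbs_le r⟩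
  rw [← sum_fiberwise_of_maps_to maps, mul_sum]
  refine sum_le_sum fun j _ => ?_
  rw [sum_congr rfl fun r hr => congrArg F (mem_filter.mp hr).2, sum_const, nsmul_eq_mul]
  gcongr
  · exact hF j
  · exact_mod_cast (card_le_card (filter_subset_filter _ (subset_univ _))).trans
      (card_filter_natAbs_valMinAbs_eq_le j)

theorem card_filter_Ico_intCast_eq_le (x : ℤ) (n : ℕ) (r : ZMod q) :
    (#{k ∈ Ico x (x + n) | ((k : ℤ) : ZMod q) = r} : ℝ) ≤ n / q + 1 := by
  have modEq : ({k ∈ Ico x (x + n) | ((k : ℤ) : ZMod q) = r} : Finset ℤ) =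
      {k ∈ Ico x (x + n) | k ≡ r.valMinAbs [ZMOD q]} :=
    filter_congr fun k _ => by rw [← intCast_eq_intCast_iff, coe_valMinAbs]
  have card := Int.Ico_filter_modEq_card x (x + n) (r := q) (mod_cast NeZero.pos q) r.valMinAbs
  rw [← modEq] at card
  suffices ((#{k ∈ Ico x (x + n) | ((k : ℤ) : ZMod q) = r} : ℤ) : ℚ) ≤ n / q + 1 by
    simpa using (Rat.cast_le (K := ℝ)).mpr this
  rw [card, Int.cast_max, Int.cast_zero, Int.cast_sub]
  refine max_le ?_ (by positivity)
  push_cast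
  have upper := Int.ceil_lt_add_one (((x : ℚ) + n - r.valMinAbs) / q)
  have lower := Int.le_ceil (((x : ℚ) - r.valMinAbs) / q)
  rw [show ((x : ℚ) + n - r.valMinAbs) / q = (x - r.valMinAbs) / q + n / q by ring] at *
  linarith

theorem sum_Ico_intCast_le {F : ZMod q → ℝ} (hF : ∀ r, 0 ≤ F r) (x : ℤ) (n : ℕ) :
    ∑ k ∈ Ico x (x + n), F k ≤ (n / q + 1) * ∑ r, F r := by
  rw [← sum_fiberwise_of_maps_to (t := univ) (g := fun k : ℤ => (k : ZMod q)) (by simp), mul_sum]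
  refine sum_le_sum fun r _ => ?_
  rw [sum_congr rfl fun k hk => congrArg F (mem_filter.mp hk).2, sum_const, nsmul_eq_mul]
  exact mul_le_mul_of_nonneg_right (card_filter_Ico_intCast_eq_le x n r) (hF r)

theorem card_filter_intCast_mul_eq_le (τ : ℤ) (r : ZMod q) :
    #{k : ZMod q | (τ : ZMod q) * k = r} ≤ τ.gcd q := by
  have hpos : 0 < τ.gcd q := Int.gcd_pos_of_ne_zero_right _ (mod_cast NeZero.ne q)
  obtain h | ⟨k₀, hk₀⟩ := ({k | (τ : ZMod q) * k = r} : Finset (ZMod q)).eq_empty_or_nonempty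
  · simp [h]
  refine le_trans ?_ (IsAddCyclic.card_nsmul_eq_zero_le (α := ZMod q) hpos)
  refine card_le_card_of_injOn (· - k₀) (fun k hk => ?_) sub_left_injective.injOn
  simp only [coe_filter, mem_filter, mem_univ, true_and, Set.mem_ofPred_eq] at hk hk₀ ⊢
  have bezout : ((τ.gcd q : ℤ) : ZMod q) = τ * (τ.gcdA q : ZMod q) := by
    rw [Int.gcd_eq_gcd_ab]
    simp
  rw [nsmul_eq_mul, ← Int.cast_natCast, bezout, mul_right_comm, mul_sub, hk, hk₀, sub_self,
    zero_mul]

theorem sum_geomBound_intCast_mul_le_sum_dvd (N : ℕ) (τ : ℤ) :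
    ∑ k : ZMod q, geomBound q N (τ * k) ≤
      ∑ r : ZMod q, if τ.gcd q ∣ r.valMinAbs.natAbs then τ.gcd q * geomBound q N r else 0 := by
  rw [← sum_fiberwise_of_maps_to (t := univ) (g := fun k : ZMod q => τ * k) (by simp)]
  refine sum_le_sum fun r _ => ?_
  rw [sum_congr rfl fun k hk => congrArg (geomBound q N) (mem_filter.mp hk).2, sum_const,
    nsmul_eq_mul]
  split_ifs with hdvd
  · gcongr
    · exact geomBound_nonneg N r
    · exact card_filter_intCast_mul_eq_le τ r
  · have : ({k | (τ : ZMod q) * k = r} : Finset (ZMod q)) = ∅ :=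
      filter_eq_empty_iff.mpr fun k _ hk => hdvd (hk ▸ gcd_dvd_natAbs_valMinAbs_intCast_mul τ k)
    simp [this]

theorem sum_geomBound_intCast_mul_le (N : ℕ) (τ : ℤ) :
    ∑ k : ZMod q, geomBound q N (τ * k) ≤ τ.gcd q * N + q * (1 + Real.log q) := by
  have fibres := sum_geomBound_intCast_mul_le_sum_dvd (q := q) N τ
  set G := τ.gcd q
  have hG : 0 < G := Int.gcd_pos_of_ne_zero_right _ (mod_cast NeZero.ne q)
  have nonzero : ∑ r : ZMod q with r ≠ 0,
      (if G ∣ r.valMinAbs.natAbs then G * geomBound q N r else 0) ≤ q * (1 + Real.log q) := by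
    calc _ = ∑ r : ZMod q with r ≠ 0,
          (fun j : ℕ => if G ∣ j then G * (q / (2 * j) : ℝ) else 0) r.valMinAbs.natAbs :=
        sum_congr rfl fun r hr => by rw [geomBound, if_neg (mem_filter.mp hr).2]
      _ ≤ 2 * ∑ j ∈ Icc 1 (q / 2), (if G ∣ j then G * (q / (2 * j) : ℝ) else 0) :=
        sum_ne_zero_natAbs_valMinAbs_le (F := fun j => if G ∣ j then G * (q / (2 * j) : ℝ) else 0)
          fun j => by positivity
      _ ≤ 2 * ∑ j ∈ Icc 1 q, (if G ∣ j then G * (q / (2 * j) : ℝ) else 0) := by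
        gcongr
        exact Nat.div_le_self q 2
      _ = G * q * ∑ j ∈ Icc 1 q with G ∣ j, (j : ℝ)⁻¹ := by
        rw [← sum_filter, mul_sum, mul_sum]
        refine sum_congr rfl fun j _ => ?_
        ring
      _ ≤ G * q * ((1 + Real.log q) / G) := by
        gcongr
        exact sum_Icc_one_filter_dvd_inv_le hG q
      _ = q * (1 + Real.log q) := by field_simp
  have zero : ∑ r : ZMod q with ¬ r ≠ 0,
      (if G ∣ r.valMinAbs.natAbs then G * geomBound q N r else 0) = G * N := by
    simp [filter_eq', geomBound]
  calc _ ≤ _ := fibres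
    _ = _ := (sum_filter_add_sum_filter_not univ (· ≠ 0) _).symm
    _ ≤ _ := by
      rw [zero, add_comm]
      gcongr

theorem norm_sq_sum_Ico_stdAddChar_mul_sq_le_gcd (h x : ℤ) (N : ℕ) :
    ‖∑ b ∈ Ico x (x + N), stdAddChar (h * b ^ 2 : ZMod q)‖ ^ 2 ≤
      (2 * N / q + 1) * ((2 * h).gcd q * N + q * (1 + Real.log q)) := by
  have complete := sum_Ico_intCast_le (q := q) (F := fun r => geomBound q N (2 * h * r))
    (fun r => geomBound_nonneg N _) (-N) (2 * N)
  rw [show (-N : ℤ) + (2 * N : ℕ) = N by lia] at complete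
  calc _ ≤ _ := norm_sq_sum_Ico_stdAddChar_mul_sq_le (h : ZMod q) x N
    _ ≤ (2 * N / q + 1) * ∑ r : ZMod q, geomBound q N (2 * (h : ZMod q) * r) :=
      mod_cast complete
    _ ≤ _ := by
      gcongr
      exact_mod_cast sum_geomBound_intCast_mul_le N (2 * h)

theorem natCast_mul_card_filter_eq_sum_stdAddChar {ι κ : Type*} (s : Finset ι) (t : Finset κ)
    (f : ι → ZMod q) (g : κ → ZMod q) :
    (q : ℂ) * #{p ∈ s ×ˢ t | f p.1 = g p.2} =
      ∑ h : ZMod q, (∑ i ∈ s, stdAddChar (h * f i)) * ∑ j ∈ t, stdAddChar (-h * g j) := by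
  have product : ∀ h : ZMod q, (∑ i ∈ s, stdAddChar (h * f i)) * ∑ j ∈ t, stdAddChar (-h * g j) =
      ∑ p ∈ s ×ˢ t, stdAddChar (h * (f p.1 - g p.2)) := fun h => by
    simp_rw [sum_mul_sum, ← sum_product', ← AddChar.map_add_eq_mul, mul_sub, neg_mul,
      sub_eq_add_neg]
  simp_rw [product]
  rw [sum_comm]
  simp_rw [AddChar.sum_mulShift _ (isPrimitive_stdAddChar q), ZMod.card, sub_eq_zero]
  rw [← Nat.cast_sum, ← sum_filter, sum_const, nsmul_eq_mul, mul_comm, Nat.cast_mul]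
  rfl

theorem abs_card_filter_eq_intCast_sub_le {ι : Type*} (s : Finset ι) (f : ι → ZMod q) (x : ℤ)
    (N : ℕ) :
    |(#{p ∈ s ×ˢ Ico x (x + N) | f p.1 = p.2} : ℝ) - #s * N / q| ≤
      ∑ h : ZMod q with h ≠ 0, ‖∑ i ∈ s, stdAddChar (h * f i)‖ / (2 * h.valMinAbs.natAbs) := by
  have hq : (q : ℂ) ≠ 0 := NeZero.ne _
  have expand := natCast_mul_card_filter_eq_sum_stdAddChar s (Ico x (x + N)) f fun d => (d : ZMod q)
  have zero : ∑ h : ZMod q with ¬ h ≠ 0, (∑ i ∈ s, stdAddChar (h * f i)) *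
      ∑ d ∈ Ico x (x + N), stdAddChar (-h * d : ZMod q) = #s * N := by
    simp [filter_eq']
  rw [← sum_filter_add_sum_filter_not univ (· ≠ 0), zero] at expand
  have error : (((#{p ∈ s ×ˢ Ico x (x + N) | f p.1 = p.2} : ℝ) - #s * N / q : ℝ) : ℂ) =
      (∑ h : ZMod q with h ≠ 0, (∑ i ∈ s, stdAddChar (h * f i)) *
        ∑ d ∈ Ico x (x + N), stdAddChar (-h * d : ZMod q)) / q := by
    rw [eq_div_iff hq, eq_sub_of_add_eq expand.symm]
    push_cast
    field_simp
  rw [← Real.norm_eq_abs, ← Complex.norm_real, error, norm_div, Complex.norm_natCast,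
    div_le_iff₀ (mod_cast NeZero.pos q), sum_mul]
  refine (norm_sum_le _ _).trans (sum_le_sum fun h hh => ?_)
  have interval : ‖∑ d ∈ Ico x (x + N), stdAddChar (-h * d : ZMod q)‖ ≤
      q / (2 * h.valMinAbs.natAbs) := by
    have := norm_sum_Ico_stdAddChar_mul_le (-h) (le_refl (x + N))
    rwa [geomBound, if_neg (neg_ne_zero.mpr (mem_filter.mp hh).2), natAbs_valMinAbs_neg] at this
  calc _ ≤ ‖∑ i ∈ s, stdAddChar (h * f i)‖ * (q / (2 * h.valMinAbs.natAbs)) := by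
        rw [norm_mul]
        gcongr
    _ = _ := by ring

end Residues

section SquareRootSums

open Finset

theorem sum_Icc_one_inv_sqrt_le (n : ℕ) : ∑ i ∈ Icc 1 n, (√i)⁻¹ ≤ 2 * √n := by
  induction n with
  | zero => simp
  | succ n ih =>
    have hsq : √(n : ℝ) ^ 2 = n := Real.sq_sqrt n.cast_nonneg
    have hsq' : √((n + 1 : ℕ) : ℝ) ^ 2 = n + 1 := by
      rw [Real.sq_sqrt (Nat.cast_nonneg _), Nat.cast_succ]
    have step : (√((n + 1 : ℕ) : ℝ))⁻¹ ≤ 2 * √((n + 1 : ℕ) : ℝ) - 2 * √(n : ℝ) := by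
      rw [inv_le_iff_one_le_mul₀ (by positivity)]
      linarith [two_mul_le_add_sq √(n : ℝ) √((n + 1 : ℕ) : ℝ)]
    rw [sum_Icc_succ_top (Nat.le_add_left 1 n)]
    linarith

theorem sum_Icc_one_inv_mul_sqrt_le (n : ℕ) : ∑ i ∈ Icc 1 n, (i * √i)⁻¹ ≤ 3 := by
  obtain rfl | hn := n.eq_zero_or_pos
  · simp
  suffices ∑ i ∈ Icc 1 n, (i * √i)⁻¹ ≤ 3 - 2 / √n from
    this.trans (sub_le_self _ (by positivity))
  induction n, hn using Nat.le_induction with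
  | base => norm_num
  | succ n hn ih =>
    have hs : 0 < √(n : ℝ) := Real.sqrt_pos.mpr (mod_cast hn)
    have hsq : √(n : ℝ) ^ 2 = n := Real.sq_sqrt n.cast_nonneg
    have hsq' : √((n + 1 : ℕ) : ℝ) ^ 2 = n + 1 := by
      rw [Real.sq_sqrt (Nat.cast_nonneg _), Nat.cast_succ]
    have hle : √(n : ℝ) ≤ √((n + 1 : ℕ) : ℝ) := by gcongr; exact n.le_succ
    rw [sum_Icc_succ_top (Nat.le_add_left 1 n), Nat.cast_succ n, ← Nat.cast_succ n]
    set s := √(n : ℝ)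
    set t := √((n + 1 : ℕ) : ℝ)
    have ht : 0 < t := hs.trans_le hle
    have step : (((n + 1 : ℕ) : ℝ) * t)⁻¹ ≤ 2 / s - 2 / t := by
      rw [div_sub_div _ _ hs.ne' ht.ne', inv_eq_one_div, div_le_div_iff₀ (by positivity)
        (by positivity), Nat.cast_succ, ← hsq']
      nlinarith [mul_nonneg ht.le (sub_nonneg.mpr hle), mul_pos hs ht]
    linarith

theorem sum_Icc_one_filter_dvd_inv_sqrt_le {d : ℕ} (hd : 0 < d) (n : ℕ) :
    ∑ i ∈ Icc 1 n with d ∣ i, (√i)⁻¹ ≤ 2 * √n / d := by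
  rw [sum_Icc_one_filter_dvd _ hd]
  calc ∑ i ∈ Icc 1 (n / d), (√(d * i : ℕ))⁻¹ = (∑ i ∈ Icc 1 (n / d), (√i)⁻¹) / √d := by
        simp only [Nat.cast_mul, Real.sqrt_mul (Nat.cast_nonneg d), mul_inv_rev, sum_mul,
          div_eq_mul_inv]
    _ ≤ 2 * √(n / d : ℝ) / √d := by
        gcongr
        refine (sum_Icc_one_inv_sqrt_le _).trans ?_
        gcongr
        exact Nat.cast_div_le
    _ = 2 * √n / d := by
        rw [Real.sqrt_div (Nat.cast_nonneg n), mul_div_assoc, div_div,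
          Real.mul_self_sqrt (Nat.cast_nonneg d), mul_div_assoc]

theorem sqrt_gcd_le_sum_sqrt {j n : ℕ} (hj : 0 < j) {J : ℕ} (hJ : j ≤ J) :
    √(j.gcd n) ≤ ∑ d ∈ Icc 1 J, if d ∣ j ∧ d ∣ n then √d else 0 := by
  have mem : j.gcd n ∈ Icc 1 J :=
    mem_Icc.mpr ⟨Nat.gcd_pos_of_pos_left _ hj, (Nat.gcd_le_left _ hj).trans hJ⟩
  have := single_le_sum (f := fun d : ℕ => if d ∣ j ∧ d ∣ n then √(d : ℝ) else 0)
    (fun d _ => by positivity) mem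
  simpa [Nat.gcd_dvd_left, Nat.gcd_dvd_right] using this

theorem sum_sum_inv_mul_sqrt_gcd_le (A J : ℕ) :
    ∑ a ∈ Icc 1 A, ∑ j ∈ Icc 1 J, (j : ℝ)⁻¹ * (√(j.gcd a) / √a) ≤
      6 * (√A * (1 + Real.log J)) := by
  have : 0 ≤ Real.log J := Real.log_natCast_nonneg J
  calc _ ≤ ∑ a ∈ Icc 1 A, ∑ j ∈ Icc 1 J, (j : ℝ)⁻¹ *
          ((∑ d ∈ Icc 1 J, if d ∣ j ∧ d ∣ a then √(d : ℝ) else 0) / √a) := by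
        gcongr with a _ j hj
        exact sqrt_gcd_le_sum_sqrt (mem_Icc.mp hj).1 (mem_Icc.mp hj).2
    _ = ∑ d ∈ Icc 1 J, √d * ((∑ j ∈ Icc 1 J with d ∣ j, (j : ℝ)⁻¹) *
          ∑ a ∈ Icc 1 A with d ∣ a, (√a)⁻¹) := by
        simp_rw [sum_filter, sum_mul_sum, sum_div, mul_sum]
        rw [sum_congr rfl fun a _ => sum_comm, sum_comm]
        refine sum_congr rfl fun d _ => ?_
        rw [sum_comm]
        refine sum_congr rfl fun j _ => sum_congr rfl fun a _ => ?_
        by_cases hj : d ∣ j <;> by_cases ha : d ∣ a <;>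
          simp only [hj, ha, if_true, if_false, and_self, and_true, and_false] <;> ring
    _ ≤ ∑ d ∈ Icc 1 J, √d * ((1 + Real.log J) / d * (2 * √A / d)) := by
        gcongr with d hd
        · exact sum_Icc_one_filter_dvd_inv_le (mem_Icc.mp hd).1 J
        · exact sum_Icc_one_filter_dvd_inv_sqrt_le (mem_Icc.mp hd).1 A
    _ = 2 * (√A * (1 + Real.log J)) * ∑ d ∈ Icc 1 J, (d * √d)⁻¹ := by
        rw [mul_sum]
        refine sum_congr rfl fun d hd => ?_
        have hd : (0 : ℝ) < d := mod_cast (mem_Icc.mp hd).1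
        field_simp
        rw [Real.sq_sqrt hd.le]
    _ ≤ 2 * (√A * (1 + Real.log J)) * 3 := by
        gcongr
        exact sum_Icc_one_inv_mul_sqrt_le J
    _ = _ := by ring

end SquareRootSums

section SquareCongruences

open Finset ZMod

variable {q : ℕ} [NeZero q]

theorem norm_sum_Ico_stdAddChar_mul_sq_le (h x : ℤ) {N : ℕ} {Y : ℝ} (hN : N ≤ Y) (hq : q ≤ Y) :
    ‖∑ b ∈ Ico x (x + N), stdAddChar (h * b ^ 2 : ZMod q)‖ ≤
      2 * (Y * √((2 * h).gcd q / q) + √(Y * (1 + Real.log Y))) := by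
  set g : ℝ := (((2 * h).gcd q : ℕ) : ℝ)
  have hq₁ : (1 : ℝ) ≤ q := by exact_mod_cast NeZero.one_le
  have hY : 1 ≤ Y := hq₁.trans hq
  have hlogY : 0 ≤ Real.log Y := Real.log_nonneg hY
  refine abs_le_of_sq_le_sq' ?_ (by positivity) |>.2
  calc _ ≤ (2 * N / q + 1) * (g * N + q * (1 + Real.log q)) :=
        norm_sq_sum_Ico_stdAddChar_mul_sq_le_gcd h x N
    _ ≤ (2 * Y / q + Y / q) * (g * Y + q * (1 + Real.log Y)) := by
        have := Real.log_nonneg hq₁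
        gcongr
        exact (one_le_div (by positivity)).mpr hq
    _ = 3 * (Y ^ 2 * (g / q) + Y * (1 + Real.log Y)) := by
        field_simp
        ring
    _ = 3 * ((Y * √(g / q)) ^ 2 + √(Y * (1 + Real.log Y)) ^ 2) := by
        rw [mul_pow, Real.sq_sqrt (by positivity), Real.sq_sqrt (by positivity)]
    _ ≤ _ := by
        have : 0 ≤ Y * √(g / q) * √(Y * (1 + Real.log Y)) := by positivity
        linarith [sq_nonneg (Y * √(g / q)), sq_nonneg √(Y * (1 + Real.log Y))]

/-- The number of integers `d` with `|d| ≤ M` that are congruent to `b ^ 2` modulo `q`: the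
candidates for the discriminant of a quadratic polynomial with middle coefficient `b`, when
`q = 4 * a` for the leading coefficient `a`. -/
noncomputable def sqCongrCount (q M : ℕ) (b : ℤ) : ℕ :=
  #{d ∈ Icc (-M : ℤ) M | (b : ZMod q) ^ 2 = (d : ℤ)}

theorem Icc_neg_eq_Ico (n : ℕ) : Icc (-n : ℤ) n = Ico (-n : ℤ) (-n + (2 * n + 1 : ℕ)) := by
  ext b
  rw [mem_Icc, mem_Ico]
  lia

theorem sqCongrCount_le (M : ℕ) (b : ℤ) : (sqCongrCount q M b : ℝ) ≤ (2 * M + 1) / q + 1 := by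
  have := card_filter_Ico_intCast_eq_le (-M) (2 * M + 1) ((b : ZMod q) ^ 2)
  rw [← Icc_neg_eq_Ico] at this
  simpa only [sqCongrCount, eq_comm, Nat.cast_add, Nat.cast_mul, Nat.cast_ofNat, Nat.cast_one]
    using this

theorem abs_sum_sqCongrCount_sub_le (M : ℕ) {β : ℕ} {Y : ℝ} (hβ : 2 * β + 1 ≤ Y) (hq : q ≤ Y) :
    |∑ b ∈ Icc (-β : ℤ) β, (sqCongrCount q M b : ℝ) - (2 * β + 1) * (2 * M + 1) / q| ≤
      ∑ j ∈ Icc 1 (q / 2), (j : ℝ)⁻¹ *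
        (2 * (Y * √((2 * j).gcd q / q) + √(Y * (1 + Real.log Y)))) := by
  have card : ∑ b ∈ Icc (-β : ℤ) β, sqCongrCount q M b =
      #{p ∈ Icc (-β : ℤ) β ×ˢ Icc (-M : ℤ) M | (p.1 : ZMod q) ^ 2 = p.2} := by
    simp only [sqCongrCount, card_filter, sum_product]
  have count := abs_card_filter_eq_intCast_sub_le (Icc (-β : ℤ) β) (fun b => (b : ZMod q) ^ 2)
    (-M) (2 * M + 1)
  rw [← Icc_neg_eq_Ico, ← card] at count
  simp only [Icc_neg_eq_Ico β, Int.card_Ico, add_sub_cancel_left, Int.toNat_natCast] at count ⊢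
  push_cast at count ⊢
  let F (j : ℕ) : ℝ :=
    2 * (Y * √((2 * j).gcd q / q) + √(Y * (1 + Real.log Y))) / (2 * j)
  have hY : 0 ≤ Y := q.cast_nonneg.trans hq
  calc _ ≤ _ := count
    _ ≤ ∑ h : ZMod q with h ≠ 0, F h.valMinAbs.natAbs := by
        refine sum_le_sum fun h _ => ?_
        have := norm_sum_Ico_stdAddChar_mul_sq_le (q := q) h.valMinAbs (-β)
          (N := 2 * β + 1) (by exact_mod_cast hβ) hq
        rw [coe_valMinAbs, Int.gcd, Int.natAbs_mul] at this
        simp only [F]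
        gcongr
        exact_mod_cast this
    _ ≤ 2 * ∑ j ∈ Icc 1 (q / 2), F j := sum_ne_zero_natAbs_valMinAbs_le fun j => by positivity
    _ = _ := by
        rw [mul_sum]
        refine sum_congr rfl fun j _ => ?_
        simp only [F]
        ring

theorem gcd_two_mul_four_mul_le (j : ℕ) {a : ℕ} (ha : 0 < a) :
    (2 * j).gcd (4 * a) ≤ 4 * j.gcd a := by
  rw [← Nat.gcd_mul_left]
  refine Nat.le_of_dvd (Nat.gcd_pos_of_pos_right _ (by positivity))
    (Nat.gcd_dvd_gcd_of_dvd_left _ ?_)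
  exact ⟨2, by ring⟩

theorem abs_sum_sqCongrCount_four_mul_sub_le (M : ℕ) {R a β : ℕ} (ha : 0 < a) (haR : a ≤ R)
    (hβ : β ≤ R) :
    |∑ b ∈ Icc (-β : ℤ) β, (sqCongrCount (4 * a) M b : ℝ) -
        (2 * β + 1) * (2 * M + 1) / (4 * a)| ≤
      ∑ j ∈ Icc 1 (2 * R), (j : ℝ)⁻¹ *
        (2 * (4 * R * (√(j.gcd a) / √a) + √(4 * R * (1 + Real.log (4 * R))))) := by
  have : NeZero (4 * a) := ⟨by lia⟩
  have hR₁ : (1 : ℝ) ≤ R := mod_cast ha.trans_le haR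
  have : 0 ≤ 1 + Real.log (4 * R) := add_nonneg zero_le_one (Real.log_nonneg (by linarith))
  have hβ' : (2 * β + 1 : ℝ) ≤ 4 * R := by exact_mod_cast (by lia)
  have haR' : ((4 * a : ℕ) : ℝ) ≤ 4 * R := by exact_mod_cast (by lia)
  have bound := abs_sum_sqCongrCount_sub_le M hβ' haR'
  rw [Nat.cast_mul, Nat.cast_ofNat] at bound
  refine bound.trans ((sum_le_sum fun j _ => ?_).trans
    (sum_le_sum_of_subset_of_nonneg (Icc_subset_Icc_right (by lia)) fun j _ _ => by positivity))
  gcongr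
  rw [← Real.sqrt_div (Nat.cast_nonneg _)]
  refine Real.sqrt_le_sqrt ?_
  rw [div_le_div_iff₀ (by positivity) (by positivity)]
  exact_mod_cast (Nat.mul_le_mul_right a (gcd_two_mul_four_mul_le j ha)).trans_eq (by ring)

theorem sum_abs_sum_sqCongrCount_sub_le {R : ℕ} (M : ℕ) {β : ℕ → ℕ} (hβ : ∀ a, β a ≤ R) :
    ∑ a ∈ Icc 1 R, |∑ b ∈ Icc (-β a : ℤ) (β a), (sqCongrCount (4 * a) M b : ℝ) -
        (2 * β a + 1) * (2 * M + 1) / (4 * a)| ≤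
      52 * (R * (1 + Real.log (4 * R)) * √(R * (1 + Real.log (4 * R)))) := by
  obtain rfl | hR := R.eq_zero_or_pos
  · simp
  have hR₁ : (1 : ℝ) ≤ R := mod_cast hR
  set L := 1 + Real.log (4 * R)
  have hL : 1 + Real.log (2 * R : ℕ) ≤ L := by
    refine add_le_add_right (Real.log_le_log (by positivity) ?_) 1
    push_cast
    linarith
  have hL₁ : 1 ≤ L := le_add_of_nonneg_right (Real.log_nonneg (by linarith))
  calc _ ≤ _ := sum_le_sum fun a ha =>
        abs_sum_sqCongrCount_four_mul_sub_le M (mem_Icc.mp ha).1 (mem_Icc.mp ha).2 (hβ a)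
    _ = 8 * R * (∑ a ∈ Icc 1 R, ∑ j ∈ Icc 1 (2 * R), (j : ℝ)⁻¹ * (√(j.gcd a) / √a)) +
        R * (2 * √(4 * R * L) * ∑ j ∈ Icc 1 (2 * R), (j : ℝ)⁻¹) := by
        have const (c : ℝ) : R * c = ∑ _ ∈ Icc 1 R, c := by simp
        rw [const]
        simp only [mul_sum, ← sum_add_distrib]
        refine sum_congr rfl fun a _ => sum_congr rfl fun j _ => ?_
        ring
    _ ≤ 8 * R * (6 * (√R * L)) + R * (2 * √(4 * R * L) * L) := by
        gcongr
        · refine (sum_sum_inv_mul_sqrt_gcd_le R (2 * R)).trans ?_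
          gcongr
        · exact (sum_Icc_one_inv_le (2 * R)).trans hL
    _ ≤ 8 * R * (6 * (√(R * L) * L)) + R * (2 * (2 * √(R * L)) * L) := by
        rw [mul_assoc 4, Real.sqrt_mul zero_le_four, show √(4 : ℝ) = 2 by norm_num]
        gcongr
        exact le_mul_of_one_le_right R.cast_nonneg hL₁
    _ = _ := by ring

end SquareCongruences

section BoundaryTerms

open Finset

/-- The number of integers `c` with `|c| ≤ R` for which `a * x ^ 2 + b * x + c` has discriminant
at most `M` in absolute value. -/
noncomputable def constCoeffCount (R M : ℕ) (a b : ℤ) : ℕ :=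
  #{c ∈ Icc (-R : ℤ) R | |b ^ 2 - 4 * a * c| ≤ (M : ℤ)}

theorem constCoeffCount_neg (R M : ℕ) (a b : ℤ) :
    constCoeffCount R M (-a) b = constCoeffCount R M a b := by
  refine card_nbij' Neg.neg Neg.neg ?_ ?_ (fun c _ => neg_neg c) (fun c _ => neg_neg c) <;>
  · intro c hc
    simp only [coe_filter, mem_Icc, Set.mem_ofPred_eq, mul_neg, neg_mul, neg_neg] at hc ⊢
    exact ⟨by lia, hc.2⟩

theorem constCoeffCount_eq_card (R M : ℕ) {a : ℕ} (ha : 0 < a) (b : ℤ) :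
    constCoeffCount R M a b =
      #{d ∈ Icc (-M : ℤ) M | (b : ZMod (4 * a)) ^ 2 = (d : ℤ) ∧ |b ^ 2 - d| ≤ (4 * a * R : ℤ)} := by
  have ha' : (0 : ℤ) < 4 * a := by positivity
  have abs_const_le (c : ℤ) : |c| ≤ R ↔ |b ^ 2 - (b ^ 2 - 4 * a * c)| ≤ (4 * a * R : ℤ) := by
    rw [sub_sub_cancel, abs_mul, abs_of_pos ha', mul_le_mul_iff_of_pos_left ha']
  refine card_nbij (fun c => b ^ 2 - 4 * a * c) (fun c hc => ?_) (fun c _ c' _ h => ?_)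
    (fun d hd => ?_)
  · simp only [coe_filter, mem_Icc, ← abs_le, Set.mem_ofPred_eq] at hc ⊢
    refine ⟨hc.2, ?_, (abs_const_le c).mp hc.1⟩
    rw [← Int.cast_pow, ZMod.intCast_eq_intCast_iff_dvd_sub]
    exact ⟨-c, by push_cast; ring⟩
  · exact mul_left_cancel₀ ha'.ne' (sub_right_injective h)
  · simp only [coe_filter, mem_Icc, ← abs_le, Set.mem_ofPred_eq] at hd
    obtain ⟨hdM, hmod, hdR⟩ := hd
    rw [← Int.cast_pow, ZMod.intCast_eq_intCast_iff_dvd_sub] at hmod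
    obtain ⟨c, hc⟩ := hmod
    have hd : d = b ^ 2 - 4 * a * -c := by push_cast at hc; linarith
    subst hd
    refine ⟨-c, ?_, rfl⟩
    simp only [coe_filter, mem_Icc, ← abs_le, Set.mem_ofPred_eq]
    exact ⟨(abs_const_le _).mpr hdR, hdM⟩

theorem constCoeffCount_le (R M : ℕ) {a : ℕ} (ha : 0 < a) (b : ℤ) :
    constCoeffCount R M a b ≤ sqCongrCount (4 * a) M b := by
  rw [constCoeffCount_eq_card R M ha, sqCongrCount]
  exact card_le_card (monotone_filter_right _ fun _ _ h => h.1)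

theorem constCoeffCount_eq_sqCongrCount {R M a : ℕ} (ha : 0 < a) {b : ℤ}
    (hb : b ^ 2 + M ≤ 4 * a * R) : constCoeffCount R M a b = sqCongrCount (4 * a) M b := by
  rw [constCoeffCount_eq_card R M ha, sqCongrCount]
  congr 1
  refine filter_congr fun d hd => and_iff_left_of_imp fun _ => abs_le.mpr ?_
  rw [mem_Icc] at hd
  constructor <;> linarith [sq_nonneg b]

theorem constCoeffCount_eq_zero {R M a : ℕ} (ha : 0 < a) {b : ℤ} (hb : 4 * a * R + M < b ^ 2) :
    constCoeffCount R M a b = 0 := by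
  rw [constCoeffCount_eq_card R M ha, card_eq_zero, filter_eq_empty_iff]
  rintro d hd ⟨-, h⟩
  linarith [(abs_le.mp h).2, (mem_Icc.mp hd).2]

theorem abs_constCoeffCount_sub_le (R M : ℕ) {a : ℕ} (ha : 0 < a) (b : ℤ) :
    |(constCoeffCount R M a b : ℝ) -
        if b ^ 2 ≤ 4 * (a : ℤ) * R then (sqCongrCount (4 * a) M b : ℝ) else 0| ≤
      if |b ^ 2 - 4 * (a : ℤ) * R| ≤ (M : ℤ) then (sqCongrCount (4 * a) M b : ℝ) else 0 := by
  by_cases near : |b ^ 2 - 4 * (a : ℤ) * R| ≤ (M : ℤ)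
  · have le : (constCoeffCount R M a b : ℝ) ≤ sqCongrCount (4 * a) M b :=
      mod_cast constCoeffCount_le R M ha b
    rw [if_pos near]
    split_ifs
    · rw [abs_sub_comm, abs_of_nonneg (sub_nonneg.mpr le)]
      exact sub_le_self _ (Nat.cast_nonneg _)
    · rwa [sub_zero, Nat.abs_cast]
  · rw [if_neg near]
    obtain above | below := lt_abs.mp (not_le.mp near)
    · rw [constCoeffCount_eq_zero ha (by linarith), if_neg (by linarith)]
      simp
    · rw [constCoeffCount_eq_sqCongrCount ha (by linarith), if_pos (by linarith)]
      simp

/-- The largest absolute value of an integer `b` with `|b| ≤ R` and `b ^ 2 ≤ 4 * a * R`. -/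
def midCoeffBound (R a : ℕ) : ℕ :=
  min R (Nat.sqrt (4 * a * R))

theorem midCoeffBound_le (R a : ℕ) : midCoeffBound R a ≤ R :=
  min_le_left _ _

theorem filter_sq_le_eq_Icc_midCoeffBound (R a : ℕ) :
    {b ∈ Icc (-R : ℤ) R | b ^ 2 ≤ 4 * (a : ℤ) * R} =
      Icc (-midCoeffBound R a : ℤ) (midCoeffBound R a) := by
  ext b
  have sq_le : b ^ 2 ≤ 4 * (a : ℤ) * R ↔ b.natAbs ≤ Nat.sqrt (4 * a * R) := by
    rw [Nat.le_sqrt', ← Int.natAbs_sq]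
    norm_cast
  rw [mem_filter, mem_Icc, mem_Icc, ← abs_le, ← abs_le, sq_le, midCoeffBound, Int.abs_eq_natAbs,
    Int.ofNat_le, Int.ofNat_le, le_min_iff]

theorem card_le_of_abs_sq_sub_le {s : Finset ℤ} {M : ℕ} {X : ℤ} (hs : ∀ b ∈ s, |b ^ 2 - X| ≤ M) :
    (#s : ℝ) ≤ 3 * √M + 2 := by
  obtain rfl | hne := s.eq_empty_or_nonempty
  · rw [card_empty, Nat.cast_zero]
    positivity
  obtain ⟨b₀, hb₀, hmin⟩ := s.exists_min_image (fun b => |b|) hne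
  set r : ℕ := Nat.sqrt (2 * M)
  have abs_lt (b : ℤ) (hb : b ∈ s) : |b| < |b₀| + (r + 1) := by
    by_contra! hge
    have hr : (2 * M : ℤ) < (r + 1) ^ 2 := mod_cast Nat.lt_succ_sqrt' (2 * M)
    have : (r + 1 : ℤ) ^ 2 ≤ b ^ 2 - b₀ ^ 2 := by
      rw [← sq_abs b, ← sq_abs b₀]
      nlinarith [abs_nonneg b₀]
    linarith [(abs_le.mp (hs b hb)).2, (abs_le.mp (hs b₀ hb₀)).1]
  have subset : s ⊆ Icc |b₀| (|b₀| + r) ∪ Icc (-|b₀| - r) (-|b₀|) := fun b hb => by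
    have := abs_lt b hb
    have := hmin b hb
    rw [mem_union, mem_Icc, mem_Icc]
    rcases abs_cases b with h | h <;> lia
  have card_le : #s ≤ 2 * (r + 1) := by
    refine (card_le_card subset).trans ((card_union_le _ _).trans ?_)
    rw [Int.card_Icc, Int.card_Icc]
    lia
  have r_le : (r : ℝ) ≤ 3 / 2 * √M := by
    refine Real.nat_sqrt_le_real_sqrt.trans (Real.sqrt_le_iff.mpr ⟨by positivity, ?_⟩)
    rw [mul_pow, Real.sq_sqrt M.cast_nonneg]
    push_cast
    linarith [M.cast_nonneg (α := ℝ)]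
  have : (#s : ℝ) ≤ 2 * (r + 1) := mod_cast card_le
  linarith

theorem abs_sum_constCoeffCount_sub_le (R M : ℕ) {a : ℕ} (ha : 0 < a) :
    |∑ b ∈ Icc (-R : ℤ) R, (constCoeffCount R M a b : ℝ) -
      ∑ b ∈ Icc (-midCoeffBound R a : ℤ) (midCoeffBound R a), (sqCongrCount (4 * a) M b : ℝ)| ≤
        (3 * √M + 2) * (M * (a : ℝ)⁻¹ + 2) := by
  have : NeZero (4 * a) := ⟨by lia⟩
  have ha₁ : (1 : ℝ) ≤ a := mod_cast ha
  have sqCongrCount_le' (b : ℤ) : (sqCongrCount (4 * a) M b : ℝ) ≤ M * (a : ℝ)⁻¹ + 2 :=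
    calc _ ≤ (2 * M + 1) / ((4 * a : ℕ) : ℝ) + 1 := sqCongrCount_le M b
      _ = (M * (a : ℝ)⁻¹) / 2 + (a : ℝ)⁻¹ / 4 + 1 := by
          push_cast
          field_simp
          ring
      _ ≤ _ := by
          have := inv_le_one_of_one_le₀ ha₁
          have : 0 ≤ M * (a : ℝ)⁻¹ := by positivity
          linarith
  rw [← filter_sq_le_eq_Icc_midCoeffBound, sum_filter, ← sum_sub_distrib]
  calc _ ≤ ∑ b ∈ Icc (-R : ℤ) R,
        if |b ^ 2 - 4 * (a : ℤ) * R| ≤ (M : ℤ) then (sqCongrCount (4 * a) M b : ℝ) else 0 :=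
        (abs_sum_le_sum_abs _ _).trans
          (sum_le_sum fun b _ => abs_constCoeffCount_sub_le R M ha b)
    _ ≤ ∑ b ∈ Icc (-R : ℤ) R with |b ^ 2 - 4 * (a : ℤ) * R| ≤ (M : ℤ), (M * (a : ℝ)⁻¹ + 2) := by
        rw [← sum_filter]
        exact sum_le_sum fun b _ => sqCongrCount_le' b
    _ ≤ _ := by
        rw [sum_const, nsmul_eq_mul]
        gcongr
        exact card_le_of_abs_sq_sub_le fun b hb => (mem_filter.mp hb).2

end BoundaryTerms

section MainTerm

open Finset MeasureTheory intervalIntegral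

/-- The function `g` for which `|b| ≤ R` and `b ^ 2 ≤ 4 * a * R` together say that
`|b| ≤ a * g (R / a)`, when `a` is positive. -/
noncomputable def midCoeffRatio (t : ℝ) : ℝ :=
  min t (2 * √t)

theorem midCoeffRatio_nonneg {t : ℝ} (ht : 0 ≤ t) : 0 ≤ midCoeffRatio t :=
  le_min ht (by positivity)

theorem monotone_midCoeffRatio : Monotone midCoeffRatio :=
  monotone_id.min (Real.sqrt_monotone.const_mul zero_le_two)

theorem midCoeffRatio_of_le_four {t : ℝ} (ht₀ : 0 ≤ t) (ht : t ≤ 4) : midCoeffRatio t = t := by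
  refine min_eq_left ?_
  have : √t ≤ 2 := Real.sqrt_le_iff.mpr ⟨zero_le_two, by linarith⟩
  nlinarith [Real.sq_sqrt ht₀, Real.sqrt_nonneg t]

theorem midCoeffRatio_of_four_le {t : ℝ} (ht : 4 ≤ t) : midCoeffRatio t = 2 * √t := by
  refine min_eq_right ?_
  have : 2 ≤ √t := Real.le_sqrt_of_sq_le (by linarith)
  nlinarith [Real.sq_sqrt (zero_le_four.trans ht)]

theorem two_mul_sqrt_div_eq {R x : ℝ} (hR : 0 ≤ R) (hx : 0 ≤ x) :
    2 * √(R / x) = 2 * √R * x ^ (-(1 / 2) : ℝ) := by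
  rw [Real.sqrt_div hR, Real.rpow_neg hx, ← Real.sqrt_eq_rpow, div_eq_mul_inv, mul_assoc]

theorem midCoeffRatio_div_le {R x : ℝ} (hR : 0 ≤ R) (hx : 0 ≤ x) :
    midCoeffRatio (R / x) ≤ 2 * √R * x ^ (-(1 / 2) : ℝ) :=
  (min_le_right _ _).trans_eq (two_mul_sqrt_div_eq hR hx)

theorem midCoeffRatio_div_eq {R x : ℝ} (hR : 0 ≤ R) (hx : 0 ≤ x) (hxR : x ≤ R / 4) :
    midCoeffRatio (R / x) = 2 * √R * x ^ (-(1 / 2) : ℝ) := by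
  obtain rfl | hx := hx.eq_or_lt
  · simp [midCoeffRatio]
  · rw [midCoeffRatio_of_four_le ((le_div_iff₀ hx).mpr (by linarith)),
      two_mul_sqrt_div_eq hR hx.le]

theorem intervalIntegrable_const_mul_rpow_neg_half (c u v : ℝ) :
    IntervalIntegrable (fun x : ℝ => c * x ^ (-(1 / 2) : ℝ)) volume u v :=
  (intervalIntegrable_rpow' (by norm_num)).const_mul c

theorem intervalIntegrable_midCoeffRatio_div {R : ℝ} (hR : 0 ≤ R) {u v : ℝ} (hu : 0 ≤ u)
    (huv : u ≤ v) : IntervalIntegrable (fun x => midCoeffRatio (R / x)) volume u v := by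
  refine (intervalIntegrable_const_mul_rpow_neg_half (2 * √R) u v).mono_fun' ?_ ?_
  · have : Measurable midCoeffRatio := monotone_midCoeffRatio.measurable
    exact (this.comp (measurable_const.div measurable_id)).aestronglyMeasurable
  · refine (ae_restrict_iff' measurableSet_uIoc).mpr (Filter.Eventually.of_forall fun x hx => ?_)
    rw [Set.uIoc_of_le huv] at hx
    have hx₀ : 0 ≤ x := hu.trans hx.1.le
    exact (Real.norm_of_nonneg (midCoeffRatio_nonneg (by positivity))).trans_le
      (midCoeffRatio_div_le hR hx₀)

theorem integral_const_mul_rpow_neg_half (c v : ℝ) :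
    ∫ x in (0 : ℝ)..v, c * x ^ (-(1 / 2) : ℝ) = 2 * c * √v := by
  rw [intervalIntegral.integral_const_mul, integral_rpow (Or.inl (by norm_num)),
    show (-(1 / 2) + 1 : ℝ) = 1 / 2 by norm_num, Real.zero_rpow (by norm_num),
    ← Real.sqrt_eq_rpow]
  ring

theorem integral_midCoeffRatio_div {R : ℝ} (hR : 0 < R) :
    ∫ x in (0 : ℝ)..R, midCoeffRatio (R / x) = 2 * (Real.log 2 + 1) * R := by
  have small_a : ∫ x in (0 : ℝ)..R / 4, midCoeffRatio (R / x) = 2 * R := by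
    calc _ = ∫ x in (0 : ℝ)..R / 4, 2 * √R * x ^ (-(1 / 2) : ℝ) :=
          integral_congr fun x hx => by
            rw [Set.uIcc_of_le (by positivity)] at hx
            exact midCoeffRatio_div_eq hR.le hx.1 hx.2
      _ = 2 * (√R * √R) := by
          rw [integral_const_mul_rpow_neg_half, Real.sqrt_div hR.le,
            show √(4 : ℝ) = 2 by norm_num]
          ring
      _ = 2 * R := by rw [Real.mul_self_sqrt hR.le]
  have large_a : ∫ x in R / 4..R, midCoeffRatio (R / x) = R * (2 * Real.log 2) := by
    calc _ = ∫ x in R / 4..R, R * (1 / x) := integral_congr fun x hx => by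
            rw [Set.uIcc_of_le (by linarith)] at hx
            have hx₀ : 0 < x := by linarith [hx.1]
            rw [midCoeffRatio_of_le_four (by positivity)
              ((div_le_iff₀ hx₀).mpr (by linarith [hx.1])), mul_one_div]
      _ = R * Real.log (2 ^ 2) := by
          rw [intervalIntegral.integral_const_mul, integral_one_div_of_pos (by positivity) hR,
            show R / (R / 4) = 2 ^ 2 by field_simp; norm_num]
      _ = R * (2 * Real.log 2) := by rw [Real.log_pow, Nat.cast_ofNat]
  rw [← integral_add_adjacent_intervals
    (intervalIntegrable_midCoeffRatio_div hR.le le_rfl (by positivity : 0 ≤ R / 4))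
    (intervalIntegrable_midCoeffRatio_div hR.le (by positivity) (by linarith)), small_a, large_a]
  ring

theorem abs_integral_one_midCoeffRatio_div_sub_le {R : ℝ} (hR : 1 ≤ R) :
    |(∫ x in (1 : ℝ)..R, midCoeffRatio (R / x)) - 2 * (Real.log 2 + 1) * R| ≤ 4 * √R := by
  have hR₀ : 0 ≤ R := by linarith
  rw [← integral_midCoeffRatio_div (by linarith), ← integral_add_adjacent_intervals
    (intervalIntegrable_midCoeffRatio_div hR₀ le_rfl zero_le_one)
    (intervalIntegrable_midCoeffRatio_div hR₀ zero_le_one hR), sub_add_cancel_right, abs_neg,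
    abs_of_nonneg (integral_nonneg zero_le_one fun x hx =>
      midCoeffRatio_nonneg (div_nonneg hR₀ hx.1))]
  calc _ ≤ ∫ x in (0 : ℝ)..1, 2 * √R * x ^ (-(1 / 2) : ℝ) :=
        integral_mono_on zero_le_one (intervalIntegrable_midCoeffRatio_div hR₀ le_rfl zero_le_one)
          (intervalIntegrable_const_mul_rpow_neg_half _ _ _)
          fun x hx => midCoeffRatio_div_le hR₀ hx.1
    _ = 4 * √R := by
        rw [integral_const_mul_rpow_neg_half, Real.sqrt_one]
        ring

theorem abs_sum_midCoeffRatio_div_sub_le {R : ℕ} (hR : 1 ≤ R) :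
    |∑ a ∈ Icc 1 R, midCoeffRatio (R / a) - 2 * (Real.log 2 + 1) * R| ≤ 6 * √R := by
  set g : ℝ → ℝ := fun x => midCoeffRatio (R / x)
  have hg : AntitoneOn g (Set.Icc ((1 : ℕ) : ℝ) R) := fun x hx y _ hxy => by
    rw [Nat.cast_one] at hx
    have : 0 < x := by linarith [hx.1]
    exact monotone_midCoeffRatio (by gcongr)
  have upper := hg.sum_le_integral_Ico hR
  have lower := hg.integral_le_sum_Ico hR
  have g_one : g 1 ≤ 2 * √R := by
    simpa [g] using midCoeffRatio_div_le R.cast_nonneg zero_le_one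
  have g_last : 0 ≤ g R := midCoeffRatio_nonneg (by positivity)
  have first : ∑ a ∈ Icc 1 R, g a = g 1 + ∑ a ∈ Ico 1 R, g (a + 1 : ℕ) := by
    rw [← Ico_add_one_right_eq_Icc, sum_eq_sum_Ico_succ_bot (by lia),
      sum_Ico_add' (fun a : ℕ => g a), Nat.cast_one]
  have last : ∑ a ∈ Icc 1 R, g a = ∑ a ∈ Ico 1 R, g a + g R := by
    rw [← Ico_add_one_right_eq_Icc, sum_Ico_succ_top hR]
  have main := abs_le.mp (abs_integral_one_midCoeffRatio_div_sub_le
    (R := R) (by exact_mod_cast hR))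
  rw [Nat.cast_one] at upper lower
  change |∑ a ∈ Icc 1 R, g a - _| ≤ _
  exact abs_le.mpr ⟨by linarith, by linarith⟩

theorem abs_two_mul_midCoeffBound_add_one_sub_le (R : ℕ) {a : ℕ} (ha : 0 < a) :
    |2 * midCoeffBound R a + 1 - 2 * (a * midCoeffRatio (R / a))| ≤ 1 := by
  have ha' : (0 : ℝ) < a := mod_cast ha
  have key : a * midCoeffRatio (R / a) = min (R : ℝ) √(4 * a * R : ℕ) := by
    rw [midCoeffRatio, mul_min_of_nonneg _ _ ha'.le, mul_div_cancel₀ _ ha'.ne']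
    congr 1
    rw [eq_comm, Real.sqrt_eq_iff_mul_self_eq (by positivity) (by positivity)]
    calc _ = 4 * (a : ℝ) ^ 2 * (R / a) := by
          push_cast
          field_simp
      _ = 4 * a ^ 2 * (√(R / a) * √(R / a)) := by rw [Real.mul_self_sqrt (by positivity)]
      _ = _ := by ring
  have lower : (midCoeffBound R a : ℝ) ≤ a * midCoeffRatio (R / a) := by
    rw [key, midCoeffBound, Nat.cast_min]
    exact min_le_min_left _ Real.nat_sqrt_le_real_sqrt
  have upper : a * midCoeffRatio (R / a) ≤ midCoeffBound R a + 1 := by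
    rw [key, midCoeffBound, Nat.cast_min, ← min_add_add_right]
    exact min_le_min (by linarith) Real.real_sqrt_lt_nat_sqrt_succ.le
  exact abs_le.mpr ⟨by linarith, by linarith⟩

theorem abs_mainTerm_sub_le {R a : ℕ} (M : ℕ) (hR : 0 < R) (ha : 0 < a) :
    |(2 * midCoeffBound R a + 1) * (2 * M + 1) / (4 * a) - M * midCoeffRatio (R / a)| ≤
      (M + R) * (a : ℝ)⁻¹ := by
  have ha' : (0 : ℝ) < a := mod_cast ha
  have hR' : (1 : ℝ) ≤ R := mod_cast hR
  set B := a * midCoeffRatio (R / a)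
  have hB₀ : 0 ≤ B := mul_nonneg ha'.le (midCoeffRatio_nonneg (by positivity))
  have hBR : B ≤ R :=
    (mul_le_mul_of_nonneg_left (min_le_left _ _) ha'.le).trans_eq (mul_div_cancel₀ _ ha'.ne')
  have hβ := abs_two_mul_midCoeffBound_add_one_sub_le R ha
  calc _ = |((2 * midCoeffBound R a + 1 - 2 * B) * (2 * M + 1) + 2 * B) / 4| * (a : ℝ)⁻¹ := by
        rw [← abs_of_pos (inv_pos.mpr ha'), ← abs_mul]
        simp only [B]
        congr 1
        field_simp
        ring
    _ ≤ _ := by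
        gcongr
        have : |(2 * midCoeffBound R a + 1 - 2 * B) * (2 * M + 1)| ≤ 1 * (2 * M + 1) := by
          rw [abs_mul, abs_of_nonneg (by positivity : (0 : ℝ) ≤ 2 * M + 1)]
          gcongr
        rw [abs_le] at this ⊢
        constructor <;> linarith [M.cast_nonneg (α := ℝ)]

end MainTerm

section Triples

open Finset

/-- The coefficients `(a, b, c)`, bounded by `R` in absolute value, of the quadratic polynomials
`a * x ^ 2 + b * x + c` whose discriminant is at most `M` in absolute value. -/
noncomputable def quadTriples (R M : ℕ) : Finset (ℤ × ℤ × ℤ) :=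
  {t ∈ Icc (-R : ℤ) R ×ˢ Icc (-R : ℤ) R ×ˢ Icc (-R : ℤ) R |
    t.1 ≠ 0 ∧ |t.2.1 ^ 2 - 4 * t.1 * t.2.2| ≤ (M : ℤ)}

theorem sum_Icc_neg_filter_ne_zero {G : Type*} [AddCommMonoid G] (f : ℤ → G) (R : ℕ) :
    ∑ a ∈ Icc (-R : ℤ) R with a ≠ 0, f a = ∑ a ∈ Icc 1 R, (f a + f (-a)) := by
  induction R with
  | zero => simp [filter_singleton]
  | succ n ih =>
    have insert_ends : {a ∈ Icc (-(n + 1 : ℕ) : ℤ) (n + 1 : ℕ) | a ≠ 0} =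
        insert ((n + 1 : ℕ) : ℤ) (insert (-((n + 1 : ℕ) : ℤ)) {a ∈ Icc (-n : ℤ) n | a ≠ 0}) := by
      ext a
      simp only [mem_filter, mem_insert, mem_Icc]
      lia
    rw [sum_Icc_succ_top (by lia), ← ih, insert_ends, sum_insert, sum_insert, ← add_assoc, add_comm]
    · simp only [mem_filter, mem_Icc]
      lia
    · simp only [mem_insert, mem_filter, mem_Icc]
      lia

theorem card_quadTriples (R M : ℕ) :
    #(quadTriples R M) = 2 * ∑ a ∈ Icc 1 R, ∑ b ∈ Icc (-R : ℤ) R, constCoeffCount R M a b := by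
  have fibers : #(quadTriples R M) =
      ∑ a ∈ Icc (-R : ℤ) R with a ≠ 0, ∑ b ∈ Icc (-R : ℤ) R, constCoeffCount R M a b := by
    simp only [quadTriples, card_filter, sum_product, sum_filter, constCoeffCount]
    refine sum_congr rfl fun a _ => ?_
    by_cases ha : a = 0 <;> simp [ha]
  rw [fibers, sum_Icc_neg_filter_ne_zero, mul_sum]
  simp only [constCoeffCount_neg, two_mul]

theorem sum_abs_sum_constCoeffCount_sub_le (R M : ℕ) :
    ∑ a ∈ Icc 1 R, |∑ b ∈ Icc (-R : ℤ) R, (constCoeffCount R M a b : ℝ) -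
      ∑ b ∈ Icc (-midCoeffBound R a : ℤ) (midCoeffBound R a), (sqCongrCount (4 * a) M b : ℝ)| ≤
        (3 * √M + 2) * (M * (1 + Real.log R) + 2 * R) := by
  calc _ ≤ ∑ a ∈ Icc 1 R, (3 * √M + 2) * (M * (a : ℝ)⁻¹ + 2) :=
        sum_le_sum fun a ha => abs_sum_constCoeffCount_sub_le R M (mem_Icc.mp ha).1
    _ = (3 * √M + 2) * (M * ∑ a ∈ Icc 1 R, (a : ℝ)⁻¹ + 2 * R) := by
        rw [← mul_sum, sum_add_distrib, ← mul_sum, sum_const, Nat.card_Icc, nsmul_eq_mul,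
          Nat.add_sub_cancel, mul_comm (R : ℝ)]
    _ ≤ _ := by
        gcongr
        exact sum_Icc_one_inv_le R

theorem sum_abs_mainTerm_sub_le (R M : ℕ) :
    ∑ a ∈ Icc 1 R, |(2 * midCoeffBound R a + 1) * (2 * M + 1) / (4 * a) -
      M * midCoeffRatio (R / a)| ≤ (M + R) * (1 + Real.log R) := by
  calc _ ≤ ∑ a ∈ Icc 1 R, (M + R) * (a : ℝ)⁻¹ := sum_le_sum fun a ha => by
          obtain ⟨ha, haR⟩ := mem_Icc.mp ha
          exact abs_mainTerm_sub_le M (by lia) ha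
    _ ≤ _ := by
        rw [← mul_sum]
        gcongr
        exact sum_Icc_one_inv_le R

theorem mul_sqrt_le_add {x y : ℝ} (hx : 0 ≤ x) (hy : 0 ≤ y) : x * √y ≤ x * √x + y * √y := by
  obtain h | h := le_total x y
  · exact (mul_le_mul_of_nonneg_right h (Real.sqrt_nonneg y)).trans
      (le_add_of_nonneg_left (by positivity))
  · exact (mul_le_mul_of_nonneg_left (Real.sqrt_le_sqrt h) hx).trans
      (le_add_of_nonneg_right (by positivity))

theorem abs_sum_sum_constCoeffCount_sub_le (R M : ℕ) :
    |∑ a ∈ Icc 1 R, ∑ b ∈ Icc (-R : ℤ) R, (constCoeffCount R M a b : ℝ) -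
      M * ∑ a ∈ Icc 1 R, midCoeffRatio (R / a)| ≤
        (3 * √M + 2) * (M * (1 + Real.log R) + 2 * R) +
          52 * (R * (1 + Real.log (4 * R)) * √(R * (1 + Real.log (4 * R)))) +
          (M + R) * (1 + Real.log R) := by
  rw [mul_sum, ← sum_sub_distrib]
  refine (abs_sum_le_sum_abs _ _).trans ?_
  refine le_trans ?_ (add_le_add (add_le_add (sum_abs_sum_constCoeffCount_sub_le R M)
    (sum_abs_sum_sqCongrCount_sub_le M (midCoeffBound_le R))) (sum_abs_mainTerm_sub_le R M))
  rw [← sum_add_distrib, ← sum_add_distrib]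
  exact sum_le_sum fun a _ =>
    (abs_sub_le _ _ _).trans (add_le_add_left (abs_sub_le _ _ _) _)

theorem quadTriples_error_le (R M : ℕ) {L : ℝ} (hL : 1 ≤ L) :
    (3 * √M + 2) * (M * L + 2 * R) + 52 * (R * L * √(R * L)) + (M + R) * L + M * (6 * √R) ≤
      69 * (M * √M * L + R * L * √(R * L)) := by
  have hL₀ : 0 ≤ L := zero_le_one.trans hL
  have le_mul_sqrt (n : ℕ) : (n : ℝ) ≤ n * √n := by
    obtain rfl | hn := n.eq_zero_or_pos
    · simp
    · exact le_mul_of_one_le_right n.cast_nonneg (Real.one_le_sqrt.mpr (mod_cast hn))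
  set U := M * √M * L
  set V := R * L * √(R * L)
  have M_sqrt_le : M * √M ≤ U := le_mul_of_one_le_right (by positivity) hL
  have ML_le : M * L ≤ U := mul_le_mul_of_nonneg_right (le_mul_sqrt M) hL₀
  have RL_sqrt_le : R * √R * L ≤ V := by
    have : √R ≤ √(R * L) := Real.sqrt_le_sqrt (le_mul_of_one_le_right R.cast_nonneg hL)
    calc _ = R * L * √R := by ring
      _ ≤ V := mul_le_mul_of_nonneg_left this (by positivity)
  have R_sqrt_le : R * √R ≤ V := (le_mul_of_one_le_right (by positivity) hL).trans RL_sqrt_le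
  have RL_le : R * L ≤ V :=
    (mul_le_mul_of_nonneg_right (le_mul_sqrt R) hL₀).trans RL_sqrt_le
  have R_le : R ≤ V := (le_mul_sqrt R).trans R_sqrt_le
  have R_sqrt_M_le := mul_sqrt_le_add R.cast_nonneg M.cast_nonneg
  have M_sqrt_R_le := mul_sqrt_le_add M.cast_nonneg R.cast_nonneg
  have : 0 ≤ U := by positivity
  calc _ = 3 * U + 6 * (R * √M) + 3 * (M * L) + 4 * R + 52 * V + R * L + 6 * (M * √R) := by
        simp only [U]
        ring
    _ ≤ _ := by linarith

theorem abs_card_quadTriples_sub_le (R M : ℕ) :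
    |(#(quadTriples R M) : ℝ) - 4 * (Real.log 2 + 1) * R * M| ≤
      138 * (M * √M * (1 + Real.log (4 * R)) +
        R * (1 + Real.log (4 * R)) * √(R * (1 + Real.log (4 * R)))) := by
  obtain rfl | hR := R.eq_zero_or_pos
  · simpa [card_quadTriples] using by positivity
  have hR₁ : (1 : ℝ) ≤ R := mod_cast hR
  have hlog : Real.log R ≤ Real.log (4 * R) := Real.log_le_log (by positivity) (by linarith)
  have fibers := abs_sum_sum_constCoeffCount_sub_le R M
  have main := abs_sum_midCoeffRatio_div_sub_le hR
  have card_eq : (#(quadTriples R M) : ℝ) =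
      2 * ∑ a ∈ Icc 1 R, ∑ b ∈ Icc (-R : ℤ) R, (constCoeffCount R M a b : ℝ) := by
    rw [card_quadTriples]
    push_cast
    rfl
  set T := ∑ a ∈ Icc 1 R, ∑ b ∈ Icc (-R : ℤ) R, (constCoeffCount R M a b : ℝ)
  set W := ∑ a ∈ Icc 1 R, midCoeffRatio (R / a)
  have error := quadTriples_error_le R M (le_add_of_nonneg_right
    (Real.log_nonneg (by linarith : (1 : ℝ) ≤ 4 * R)))
  calc _ = |2 * ((T - M * W) + M * (W - 2 * (Real.log 2 + 1) * R))| := by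
        rw [card_eq]
        ring_nf
    _ ≤ 2 * (|T - M * W| + M * |W - 2 * (Real.log 2 + 1) * R|) := by
        rw [abs_mul, abs_two, ← abs_of_nonneg (M.cast_nonneg (α := ℝ)), ← abs_mul, Nat.abs_cast]
        gcongr
        exact abs_add_le _ _
    _ ≤ 2 * ((3 * √M + 2) * (M * (1 + Real.log (4 * R)) + 2 * R) +
          52 * (R * (1 + Real.log (4 * R)) * √(R * (1 + Real.log (4 * R)))) +
          (M + R) * (1 + Real.log (4 * R)) + M * (6 * √R)) := by
        grw [fibers, main, hlog]
    _ ≤ _ := by linarith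

end Triples

section QuadraticPolynomials

theorem polyHeight_le_iff {p : ℤ[X]} {d n : ℕ} (hp : p.degree ≤ d) :
    polyHeight p ≤ n ↔ ∀ i ≤ d, |p.coeff i| ≤ (n : ℤ) := by
  simp only [polyHeight, Finset.sup_le_iff, mem_support_iff, Int.abs_eq_natAbs, Int.ofNat_le]
  refine ⟨fun h i _ => ?_, fun h i hi => h i ?_⟩
  · by_cases hi : p.coeff i = 0
    · simp [hi]
    · exact h i hi
  · exact mod_cast (le_degree_of_ne_zero hi).trans hp

theorem polyHeight_le_iff_of_degree_eq_two {p : ℤ[X]} (hp : p.degree = 2) (n : ℕ) :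
    polyHeight p ≤ n ↔ |p.coeff 2| ≤ (n : ℤ) ∧ |p.coeff 1| ≤ (n : ℤ) ∧ |p.coeff 0| ≤ (n : ℤ) := by
  rw [polyHeight_le_iff (d := 2) hp.le]
  refine ⟨fun h => ⟨h 2 le_rfl, h 1 one_le_two, h 0 zero_le_two⟩, fun ⟨h₂, h₁, h₀⟩ i hi => ?_⟩
  interval_cases i <;> assumption

theorem abs_intCast_le_iff_le_floor {D : ℝ} (hD : 0 ≤ D) (z : ℤ) :
    |(z : ℝ)| ≤ D ↔ |z| ≤ (⌊D⌋₊ : ℤ) := by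
  rw [Int.abs_eq_natAbs, Int.ofNat_le, Nat.le_floor_iff hD, Nat.cast_natAbs, Int.cast_abs]

theorem coeff_quadratic (a b c : ℤ) :
    (C a * X ^ 2 + C b * X + C c).coeff 2 = a ∧ (C a * X ^ 2 + C b * X + C c).coeff 1 = b ∧
      (C a * X ^ 2 + C b * X + C c).coeff 0 = c := by
  simp [-eq_intCast, coeff_C]

theorem mem_and_discr_le_iff_mem_quadTriples {Q D : ℝ} (hQ : 0 ≤ Q) (hD : 0 ≤ D) {p : ℤ[X]}
    (hp : p.degree = 2) :
    p ∈ polysOfHeightLE 2 Q ∧ |(p.discr : ℝ)| ≤ D ↔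
      (p.coeff 2, p.coeff 1, p.coeff 0) ∈ quadTriples ⌊Q⌋₊ ⌊D⌋₊ := by
  have lead_ne : p.coeff 2 ≠ 0 := coeff_ne_zero_of_eq_degree hp
  have hp' : p.degree = (2 : ℕ) := hp
  rw [polysOfHeightLE, Set.mem_ofPred_eq, and_iff_right hp', ← Nat.le_floor_iff hQ,
    polyHeight_le_iff_of_degree_eq_two hp, abs_intCast_le_iff_le_floor hD,
    discr_of_degree_eq_two hp, mul_right_comm]
  simp only [quadTriples, Finset.mem_filter, Finset.mem_product, Finset.mem_Icc, ← abs_le,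
    and_iff_right lead_ne]

theorem quadCount_eq_card {Q D : ℝ} (hQ : 0 ≤ Q) (hD : 0 ≤ D) :
    quadCount Q D = (quadTriples ⌊Q⌋₊ ⌊D⌋₊).card := by
  rw [quadCount, ← Set.ncard_coe_finset]
  refine Set.BijOn.ncard_eq (f := fun p => (p.coeff 2, p.coeff 1, p.coeff 0))
    ⟨fun p hp => ?_, fun p hp p' hp' h => ?_, fun t ht => ?_⟩
  · exact (mem_and_discr_le_iff_mem_quadTriples hQ hD hp.1.1).mp hp
  · obtain ⟨h₂, h₁, h₀⟩ := by simpa only [Prod.mk.injEq] using h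
    rw [eq_quadratic_of_degree_le_two hp.1.1.le, eq_quadratic_of_degree_le_two hp'.1.1.le,
      h₂, h₁, h₀]
  · obtain ⟨h₂, h₁, h₀⟩ := coeff_quadratic t.1 t.2.1 t.2.2
    have coeffs : ((C t.1 * X ^ 2 + C t.2.1 * X + C t.2.2).coeff 2,
        (C t.1 * X ^ 2 + C t.2.1 * X + C t.2.2).coeff 1,
        (C t.1 * X ^ 2 + C t.2.1 * X + C t.2.2).coeff 0) = t := by
      rw [h₂, h₁, h₀]
    refine ⟨_, (mem_and_discr_le_iff_mem_quadTriples hQ hD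
      (degree_quadratic (Finset.mem_filter.mp ht).2.1)).mpr ?_, coeffs⟩
    rwa [coeffs]

theorem abs_discr_le_of_degree_eq_two {p : ℤ[X]} (hp : p.degree = 2) :
    |p.discr| ≤ 5 * (polyHeight p : ℤ) ^ 2 := by
  obtain ⟨h₂, h₁, h₀⟩ := (polyHeight_le_iff_of_degree_eq_two hp _).mp le_rfl
  calc |p.discr| = |p.coeff 1 ^ 2 - 4 * p.coeff 0 * p.coeff 2| := by
        rw [discr_of_degree_eq_two hp]
    _ ≤ |p.coeff 1| ^ 2 + 4 * |p.coeff 0| * |p.coeff 2| := by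
        refine (abs_sub _ _).trans_eq ?_
        rw [abs_pow, abs_mul, abs_mul, abs_of_pos (four_pos : (0 : ℤ) < 4)]
    _ ≤ (polyHeight p : ℤ) ^ 2 + 4 * polyHeight p * polyHeight p := by gcongr
    _ = _ := by ring

theorem discrGamma_two : discrGamma 2 = 5 := by
  refine IsGreatest.csSup_eq ⟨?_, ?_⟩
  · set p : ℤ[X] := C 1 * X ^ 2 + C 1 * X + C (-1)
    have deg : p.degree = 2 := degree_quadratic one_ne_zero
    obtain ⟨h₂, h₁, h₀⟩ := coeff_quadratic 1 1 (-1)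
    have discr : p.discr = 5 := by rw [discr_of_degree_eq_two deg, h₂, h₁, h₀]; norm_num
    have height_le : polyHeight p ≤ 1 := by
      rw [polyHeight_le_iff_of_degree_eq_two deg, h₂, h₁, h₀]
      decide
    have height_ge : 1 ≤ polyHeight p := by
      have := abs_discr_le_of_degree_eq_two deg
      rw [discr] at this
      exact Nat.one_le_iff_ne_zero.mpr fun h => by simp [h] at this
    refine ⟨p, deg, ?_⟩
    rw [discr, le_antisymm height_le height_ge]
    norm_num
  · rintro _ ⟨p, deg, rfl⟩
    exact div_le_of_le_mul₀ (by positivity) (by norm_num)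
      (mod_cast abs_discr_le_of_degree_eq_two deg)

theorem ncard_polysOfSmallDiscr_two (Q v : ℝ) :
    (polysOfSmallDiscr 2 Q v).ncard = quadCount Q (5 * Q ^ (2 - 2 * v)) := by
  rw [polysOfSmallDiscr, quadCount, discrGamma_two, Nat.cast_ofNat,
    show (2 * 2 - 2 - 2 * v : ℝ) = 2 - 2 * v by ring]

end QuadraticPolynomials

section AsymptoticFormula

theorem rpow_three_halves {x : ℝ} (hx : 0 ≤ x) : x ^ (3 / 2 : ℝ) = x * √x := by
  rw [Real.sqrt_eq_rpow, show (3 / 2 : ℝ) = 1 + 1 / 2 by norm_num,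
    Real.rpow_add_of_nonneg hx zero_le_one (by norm_num), Real.rpow_one]

theorem mul_sqrt_mul_le {c x : ℝ} (hc : 1 ≤ c) (hx : 0 ≤ x) :
    c * x * √(c * x) ≤ c ^ 2 * (x * √x) := by
  have hc₀ : 0 ≤ c := zero_le_one.trans hc
  calc c * x * √(c * x) = c * x * (√c * √x) := by rw [Real.sqrt_mul hc₀]
    _ ≤ c * x * (c * √x) := by
        gcongr
        exact Real.sqrt_le_self_iff.mpr (.inr hc)
    _ = c ^ 2 * (x * √x) := by ring

theorem abs_floor_mul_floor_sub_le {x y : ℝ} (hx : 0 ≤ x) (hy : 0 ≤ y) :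
    |(⌊x⌋₊ : ℝ) * ⌊y⌋₊ - x * y| ≤ x + y := by
  have floor_x := Nat.floor_le hx
  have floor_y := Nat.floor_le hy
  have lt_x := Nat.lt_floor_add_one x
  have lt_y := Nat.lt_floor_add_one y
  have split : x * y - ⌊x⌋₊ * ⌊y⌋₊ = x * (y - ⌊y⌋₊) + ⌊y⌋₊ * (x - ⌊x⌋₊) := by ring
  rw [abs_sub_comm, split, abs_of_nonneg (add_nonneg (mul_nonneg hx (sub_nonneg.mpr floor_y))
    (mul_nonneg (Nat.cast_nonneg _) (sub_nonneg.mpr floor_x)))]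
  exact add_le_add (mul_le_of_le_one_right hx (by linarith))
    ((mul_le_of_le_one_right (Nat.cast_nonneg _) (by linarith)).trans floor_y)

theorem abs_quadCount_sub_le {Q D : ℝ} (hQ : 1 ≤ Q) (hD : 0 ≤ D) :
    |(quadCount Q D : ℝ) - 4 * (Real.log 2 + 1) * Q * D| ≤
      138 * (D * √D * (1 + Real.log (4 * Q)) +
        Q * (1 + Real.log (4 * Q)) * √(Q * (1 + Real.log (4 * Q)))) + 8 * (Q + D) := by
  have hQ₀ : 0 ≤ Q := zero_le_one.trans hQ
  have floor_pos : (0 : ℝ) < ⌊Q⌋₊ := mod_cast Nat.floor_pos.mpr hQ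
  have one_add_log_nonneg : 0 ≤ 1 + Real.log (4 * ⌊Q⌋₊) := by
    have : (1 : ℝ) ≤ ⌊Q⌋₊ := mod_cast floor_pos
    have := Real.log_nonneg (by linarith : (1 : ℝ) ≤ 4 * ⌊Q⌋₊)
    linarith
  have count := abs_card_quadTriples_sub_le ⌊Q⌋₊ ⌊D⌋₊
  rw [← quadCount_eq_card hQ₀ hD] at count
  calc _ = |((quadCount Q D : ℝ) - 4 * (Real.log 2 + 1) * ⌊Q⌋₊ * ⌊D⌋₊) +
          4 * (Real.log 2 + 1) * (⌊Q⌋₊ * ⌊D⌋₊ - Q * D)| := by ring_nf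
    _ ≤ _ := (abs_add_le _ _).trans (add_le_add (count.trans ?_) ?_)
  · have floor_Q := Nat.floor_le hQ₀
    have floor_D := Nat.floor_le hD
    have log_le : Real.log (4 * ⌊Q⌋₊) ≤ Real.log (4 * Q) := by gcongr
    have := one_add_log_nonneg.trans (add_le_add_right log_le 1)
    gcongr
  · have log_two_pos := Real.log_pos one_lt_two
    have log_two_lt := Real.log_two_lt_d9
    rw [abs_mul, abs_of_pos (by linarith)]
    exact mul_le_mul (by linarith) (abs_floor_mul_floor_sub_le hQ₀ hD) (abs_nonneg _) (by norm_num)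

theorem errorTerm_le {Q D k : ℝ} (hQ : 1 ≤ Q) (hD : 0 ≤ D) (hk : 1 ≤ k)
    (hkQ : 1 ≤ k * Real.log Q) :
    138 * (D * √D * (1 + Real.log (4 * Q)) +
        Q * (1 + Real.log (4 * Q)) * √(Q * (1 + Real.log (4 * Q)))) + 8 * (Q + D) ≤
      2400 * k ^ 2 * (D ^ (3 / 2 : ℝ) * Real.log Q + (Q * Real.log Q) ^ (3 / 2 : ℝ)) := by
  have hlog : 0 ≤ Real.log Q := Real.log_nonneg hQ
  have one_add_log_le : 1 + Real.log (4 * Q) ≤ 4 * k * Real.log Q := by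
    have log_four : Real.log 4 = 2 * Real.log 2 := by
      rw [← Real.log_rpow two_pos]
      norm_num
    rw [Real.log_mul four_ne_zero (by positivity), log_four]
    nlinarith [Real.log_two_lt_d9]
  rw [rpow_three_halves hD, rpow_three_halves (by positivity)]
  set U := D * √D * Real.log Q
  set V := Q * Real.log Q * √(Q * Real.log Q)
  have U_term : D * √D * (1 + Real.log (4 * Q)) ≤ 4 * k * U :=
    (mul_le_mul_of_nonneg_left one_add_log_le (by positivity)).trans_eq (by simp only [U]; ring)
  have V_term : Q * (1 + Real.log (4 * Q)) * √(Q * (1 + Real.log (4 * Q))) ≤ (4 * k) ^ 2 * V := by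
    have : Q * (1 + Real.log (4 * Q)) ≤ 4 * k * (Q * Real.log Q) :=
      (mul_le_mul_of_nonneg_left one_add_log_le (by positivity)).trans_eq (by ring)
    exact (mul_le_mul this (Real.sqrt_le_sqrt this) (Real.sqrt_nonneg _) (by positivity)).trans
      (mul_sqrt_mul_le (by linarith) (by positivity))
  have Q_le : Q ≤ k ^ 2 * V := by
    have : Q ≤ k * (Q * Real.log Q) := by nlinarith
    refine le_trans ?_ (mul_sqrt_mul_le hk (by positivity))
    exact this.trans (le_mul_of_one_le_right (by positivity) (Real.one_le_sqrt.mpr (hQ.trans this)))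
  have D_le : D ≤ Q + k * U := by
    obtain hD₁ | hD₁ := le_total D 1
    · exact (hD₁.trans hQ).trans (le_add_of_nonneg_right (by positivity))
    · calc D ≤ D * √D := le_mul_of_one_le_right hD (Real.one_le_sqrt.mpr hD₁)
        _ ≤ D * √D * (k * Real.log Q) := le_mul_of_one_le_right (by positivity) hkQ
        _ ≤ Q + k * U := by linarith [mul_left_comm (D * √D) k (Real.log Q)]
  have : 0 ≤ k * U := by positivity
  have : k * U ≤ k ^ 2 * U := mul_le_mul_of_nonneg_right (le_self_pow₀ hk two_ne_zero)
    (by positivity)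
  linarith

theorem exists_abs_quadCount_sub_le {Q₀ : ℝ} (hQ₀ : 1 < Q₀) :
    ∃ C : ℝ, 0 < C ∧ ∀ Q D : ℝ, Q₀ ≤ Q → 0 ≤ D →
      |(quadCount Q D : ℝ) - 4 * (Real.log 2 + 1) * Q * D| ≤
        C * (D ^ (3 / 2 : ℝ) * Real.log Q + (Q * Real.log Q) ^ (3 / 2 : ℝ)) := by
  have log_pos : 0 < Real.log Q₀ := Real.log_pos hQ₀
  refine ⟨2400 * (1 + (Real.log Q₀)⁻¹) ^ 2, by positivity, fun Q D hQ hD => ?_⟩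
  have hQ₁ : 1 ≤ Q := hQ₀.le.trans hQ
  refine (abs_quadCount_sub_le hQ₁ hD).trans (errorTerm_le hQ₁ hD
    (le_add_of_nonneg_right (by positivity)) ?_)
  calc 1 = (Real.log Q₀)⁻¹ * Real.log Q₀ := (inv_mul_cancel₀ log_pos.ne').symm
    _ ≤ (1 + (Real.log Q₀)⁻¹) * Real.log Q := by
        gcongr
        exact le_add_of_nonneg_left zero_le_one

end AsymptoticFormula

section OrderOfMagnitude

open Asymptotics Filter Set

theorem exists_forall_le_mul_of_isBigO_atTop {f g : ℝ → ℝ} {a : ℝ} (hf : MonotoneOn f (Ici a))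
    (hg : ∀ x ≥ a, 1 ≤ g x) (h : f =O[atTop] g) : ∃ c > 0, ∀ x ≥ a, f x ≤ c * g x := by
  obtain ⟨c, hc, bound⟩ := h.exists_pos
  obtain ⟨b, hb⟩ := eventually_atTop.mp (bound.bound.and (eventually_ge_atTop a))
  have hab : a ≤ b := (hb b le_rfl).2
  refine ⟨max c (f b), lt_max_of_lt_left hc, fun x hx => ?_⟩
  have g_pos : 0 < g x := zero_lt_one.trans_le (hg x hx)
  obtain hxb | hbx := le_total x b
  · calc f x ≤ f b := hf hx hab hxb
      _ ≤ max c (f b) := le_max_right _ _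
      _ ≤ max c (f b) * g x :=
        le_mul_of_one_le_right (hc.le.trans (le_max_left _ _)) (hg x hx)
  · calc f x ≤ ‖f x‖ := Real.le_norm_self _
      _ ≤ c * ‖g x‖ := (hb x hbx).1
      _ = c * g x := by rw [Real.norm_of_nonneg g_pos.le]
      _ ≤ max c (f b) * g x := mul_le_mul_of_nonneg_right (le_max_left _ _) g_pos.le

theorem isLittleO_quadCount_error {γ v : ℝ} (hγ : 0 ≤ γ) (hv : 0 < v) (hv' : v < 3 / 4) :
    (fun Q : ℝ => (γ * Q ^ (2 - 2 * v)) ^ (3 / 2 : ℝ) * Real.log Q +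
      (Q * Real.log Q) ^ (3 / 2 : ℝ)) =o[atTop] fun Q => Q ^ (3 - 2 * v) := by
  refine .add ?_ ?_
  · have := ((isBigO_refl (fun Q : ℝ => Q ^ (3 - 3 * v)) atTop).const_mul_left
      (γ ^ (3 / 2 : ℝ))).mul_isLittleO (isLittleO_log_rpow_atTop hv)
    refine this.congr' ?_ ?_
    · filter_upwards [eventually_gt_atTop 0] with Q hQ
      rw [Real.mul_rpow hγ (by positivity), ← Real.rpow_mul hQ.le,
        show (2 - 2 * v) * (3 / 2) = 3 - 3 * v by ring]
    · filter_upwards [eventually_gt_atTop 0] with Q hQ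
      rw [← Real.rpow_add hQ, show 3 - 3 * v + v = 3 - 2 * v by ring]
  · have := (isBigO_refl (fun Q : ℝ => Q ^ (3 / 2 : ℝ)) atTop).mul_isLittleO
      (isLittleO_log_rpow_rpow_atTop (3 / 2) (sub_pos.mpr (by linarith : 2 * v < 3 / 2)))
    refine this.congr' ?_ ?_
    · filter_upwards [eventually_ge_atTop 1] with Q hQ
      rw [Real.mul_rpow (by positivity) (Real.log_nonneg hQ)]
    · filter_upwards [eventually_gt_atTop 0] with Q hQ
      rw [← Real.rpow_add hQ, show 3 / 2 + (3 / 2 - 2 * v) = 3 - 2 * v by ring]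

theorem isEquivalent_quadCount {γ v : ℝ} (hγ : 0 < γ) (hv : 0 < v) (hv' : v < 3 / 4) :
    (fun Q => (quadCount Q (γ * Q ^ (2 - 2 * v)) : ℝ)) ~[atTop]
      fun Q => 4 * (Real.log 2 + 1) * γ * Q ^ (3 - 2 * v) := by
  have const_pos : 0 < 4 * (Real.log 2 + 1) * γ := by positivity
  obtain ⟨C, -, bound⟩ := exists_abs_quadCount_sub_le one_lt_two
  have error_isLittleO := (isLittleO_quadCount_error hγ.le hv hv').trans_isBigO
    ((isBigO_refl _ _).const_mul_right const_pos.ne')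
  refine IsBigO.trans_isLittleO (.of_bound C ?_) error_isLittleO
  filter_upwards [eventually_ge_atTop 2] with Q hQ
  have main_eq : 4 * (Real.log 2 + 1) * Q * (γ * Q ^ (2 - 2 * v)) =
      4 * (Real.log 2 + 1) * γ * Q ^ (3 - 2 * v) := by
    rw [show 3 - 2 * v = 1 + (2 - 2 * v) by ring, Real.rpow_add (by positivity), Real.rpow_one]
    ring
  have := Real.log_nonneg (by linarith : 1 ≤ Q)
  rw [Pi.sub_apply, ← main_eq, Real.norm_eq_abs, Real.norm_of_nonneg (by positivity)]
  exact bound Q _ hQ (by positivity)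

theorem quadTriples_subset {R R' M M' : ℕ} (hR : R ≤ R') (hM : M ≤ M') :
    quadTriples R M ⊆ quadTriples R' M' := by
  intro t
  simp only [quadTriples, Finset.mem_filter, Finset.mem_product, Finset.mem_Icc]
  lia

theorem monotoneOn_quadCount {γ v : ℝ} (hγ : 0 ≤ γ) (hv : v ≤ 1) :
    MonotoneOn (fun Q => (quadCount Q (γ * Q ^ (2 - 2 * v)) : ℝ)) (Ici 1) := by
  intro Q (hQ : 1 ≤ Q) Q' (hQ' : 1 ≤ Q') hle
  have : 0 ≤ 2 - 2 * v := by linarith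
  simp only
  rw [quadCount_eq_card (by positivity) (by positivity),
    quadCount_eq_card (by positivity) (by positivity)]
  exact mod_cast Finset.card_le_card (quadTriples_subset (by gcongr) (by gcongr))

theorem one_le_quadCount {Q D : ℝ} (hQ : 1 ≤ Q) (hD : 0 ≤ D) : 1 ≤ quadCount Q D := by
  rw [quadCount_eq_card (zero_le_one.trans hQ) hD, Nat.one_le_iff_ne_zero, Finset.card_ne_zero]
  have := Nat.floor_pos.mpr hQ
  refine ⟨(1, 0, 0), Finset.mem_filter.mpr ⟨?_, one_ne_zero, by simp⟩⟩
  simp only [Finset.mem_product, Finset.mem_Icc]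
  lia

theorem exists_quadCount_two_sided_bound {γ v : ℝ} (hγ : 0 < γ) (hv : 0 < v) (hv' : v < 3 / 4) :
    ∃ c₁ c₂ : ℝ, 0 < c₁ ∧ 0 < c₂ ∧ ∀ Q : ℝ, 1 ≤ Q →
      c₁ * Q ^ (3 - 2 * v) ≤ quadCount Q (γ * Q ^ (2 - 2 * v)) ∧
      quadCount Q (γ * Q ^ (2 - 2 * v)) ≤ c₂ * Q ^ (3 - 2 * v) := by
  have theta : (fun Q => (quadCount Q (γ * Q ^ (2 - 2 * v)) : ℝ)) =Θ[atTop]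
      fun Q => Q ^ (3 - 2 * v) :=
    (isEquivalent_quadCount hγ hv hv').isTheta.trans
      ((isTheta_refl _ _).const_mul_left (by positivity))
  have rpow_mono : MonotoneOn (fun Q : ℝ => Q ^ (3 - 2 * v)) (Ici 1) :=
    fun Q hQ Q' _ hle => Real.rpow_le_rpow (zero_le_one.trans hQ) hle (by linarith)
  obtain ⟨c₁, hc₁, lower⟩ := exists_forall_le_mul_of_isBigO_atTop rpow_mono
    (fun Q (hQ : 1 ≤ Q) => mod_cast one_le_quadCount hQ (by positivity)) theta.2
  obtain ⟨c₂, hc₂, upper⟩ := exists_forall_le_mul_of_isBigO_atTop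
    (monotoneOn_quadCount hγ.le (by linarith))
    (fun Q hQ => Real.one_le_rpow hQ (by linarith)) theta.1
  exact ⟨c₁⁻¹, c₂, by positivity, hc₂, fun Q hQ =>
    ⟨(inv_mul_le_iff₀ hc₁).mpr (lower Q hQ), upper Q hQ⟩⟩

end OrderOfMagnitude

theorem theorem1_general :
    (∀ Q₀ : ℝ, 1 < Q₀ → ∃ C : ℝ, 0 < C ∧ ∀ Q D : ℝ, Q₀ ≤ Q → 0 ≤ D →
      |(quadCount Q D : ℝ) - 4 * (Real.log 2 + 1) * Q * D| ≤
        C * (D ^ (3 / 2 : ℝ) * Real.log Q + (Q * Real.log Q) ^ (3 / 2 : ℝ))) ∧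
    (∀ v : ℝ, 0 < v → v < 3 / 4 →
      ∃ c₁ c₂ : ℝ, 0 < c₁ ∧ 0 < c₂ ∧ ∀ Q : ℝ, 1 < Q →
        c₁ * Q ^ (3 - 2 * v) ≤ ((polysOfSmallDiscr 2 Q v).ncard : ℝ) ∧
        ((polysOfSmallDiscr 2 Q v).ncard : ℝ) ≤ c₂ * Q ^ (3 - 2 * v)) := by
  refine ⟨fun _ => exists_abs_quadCount_sub_le, fun v hv hv' => ?_⟩
  obtain ⟨c₁, c₂, hc₁, hc₂, bounds⟩ :=
    exists_quadCount_two_sided_bound (γ := 5) (by norm_num) hv hv'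
  refine ⟨c₁, c₂, hc₁, hc₂, fun Q hQ => ?_⟩
  rw [ncard_polysOfSmallDiscr_two]
  exact bounds Q hQ.le

theorem theorem1 :
    (∃ C : ℝ, 0 < C ∧ ∀ Q D : ℝ, 1 < Q → 1 ≤ D → D ≤ Q ^ 2 / 2 →
      |(quadCount Q D : ℝ) - 4 * (Real.log 2 + 1) * Q * D| ≤
        C * (D ^ (3 / 2 : ℝ) * Real.log Q + (Q * Real.log Q) ^ (3 / 2 : ℝ))) ∧
    (∀ v : ℝ, 0 < v → v < 3 / 4 →
      ∃ c₁ c₂ : ℝ, 0 < c₁ ∧ 0 < c₂ ∧ ∀ Q : ℝ, 1 < Q →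
        c₁ * Q ^ (3 - 2 * v) ≤ ((polysOfSmallDiscr 2 Q v).ncard : ℝ) ∧
        ((polysOfSmallDiscr 2 Q v).ncard : ℝ) ≤ c₂ * Q ^ (3 - 2 * v)) :=
  ⟨(theorem1_general.1 (5 / 4) (by norm_num)).imp fun _ ⟨hC, bound⟩ =>
    ⟨hC, fun Q D _ hD _ => bound Q D (by nlinarith) (by linarith)⟩, theorem1_general.2⟩
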